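/- Throughout, a vocabulary is a computable set $\mathcal V$ of relation symbols (a relation symbol being a pair of an arity and an index), first-order logic has equality, $\mathrm{FO}$ is the set of all first-order sentences over $\mathcal V$, sentences are coded effectively by natural numbers, and finite structures are non-empty. There is a constant $N$ such that the following holds for every vocabulary $\mathcal V$ that contains at least $N$ relation symbols of arity at least $2$. **Theorem 1.1.** Let $\mathcal L \subseteq \mathrm{FO}$ be a computable set of sentences such that 1. $\mathcal L$ has the same expressive power as $\mathrm{FO}$ over finite models: for every $\tau \subseteq \mathcal V$ and every first-order sentence $\varphi$ over $\tau$ there is a sentence $\psi \in \mathcal L$ over $\tau$ that is equivalent to $\varphi$ over all finite structures; and 2. $\mathcal L$ is effectively closed under conjunction: there is a computable map $f : \mathcal L \times \mathcal L \to \mathcal L$ such that, for all $\varphi, \psi \in \mathcal L$, the sentence $f(\varphi,\psi)$ is equivalent to $\varphi \wedge \psi$ over all finite structures. Then the finite satisfiability problem of $\mathcal L$, that is, the set of all $\varphi \in \mathcal L$ that have a finite model, is RE-complete: it is recursively enumerable, and every recursively enumerable set is many-one reducible to it by a computable function. -/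

import Mathlib

open FirstOrder

namespace FinSatFragment

/-- The relational first-order language of a vocabulary `V`. A relation symbol is a pair
`(k, i)`: the `i`-th relation symbol of arity `k`. There are no function or constant symbols. -/
abbrev voc (V : Set (ℕ × ℕ)) : FirstOrder.Language.{0, 0} :=
  ⟨fun _ => Empty, fun k => {i : ℕ // (k, i) ∈ V}⟩

variable {V : Set (ℕ × ℕ)}

/-- The index of the variable that a term is (in a relational language every term of a sentence
is a bound variable). -/
def varIndex {n : ℕ} : (voc V).Term (Empty ⊕ Fin n) → ℕ
  | .var (.inl e) => e.elim
  | .var (.inr i) => i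
  | .func f _ => Empty.elim f

/-- Gödel numbering of first-order formulas. The variable bound by a quantifier at depth `n` is
the variable with index `n`, and that index is recorded in the number of the formula. -/
def code : {n : ℕ} → (voc V).BoundedFormula Empty n → ℕ
  | _, .falsum => Nat.pair 0 0
  | _, .equal t s => Nat.pair 1 (Nat.pair (varIndex t) (varIndex s))
  | _, .rel (l := k) R ts =>
      Nat.pair 2 (Nat.pair (Nat.pair k R.1)
        (Encodable.encode (List.ofFn fun i => varIndex (ts i))))
  | _, .imp φ ψ => Nat.pair 3 (Nat.pair (code φ) (code ψ))
  | n, .all φ => Nat.pair 4 (Nat.pair n (code φ))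

/-- The set of relation symbols that occur in a formula. -/
def symbols : {n : ℕ} → (voc V).BoundedFormula Empty n → Set (ℕ × ℕ)
  | _, .falsum => ∅
  | _, .equal _ _ => ∅
  | _, .rel (l := k) R _ => {(k, R.1)}
  | _, .imp φ ψ => symbols φ ∪ symbols ψ
  | _, .all φ => symbols φ

theorem varIndex_injective {n : ℕ} :
    Function.Injective (varIndex : (voc V).Term (Empty ⊕ Fin n) → ℕ) := by
  intro t s h
  match t, s with
  | .var (.inl e), _ => exact e.elim
  | .var (.inr _), .var (.inl e) => exact e.elim
  | .func f _, _ => exact Empty.elim f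
  | .var (.inr _), .func f _ => exact Empty.elim f
  | .var (.inr i), .var (.inr j) =>
    have : i = j := Fin.ext h
    rw [this]

/-- Distinct sentences have distinct Gödel numbers. -/
theorem code_injective {n : ℕ} :
    Function.Injective (code : (voc V).BoundedFormula Empty n → ℕ) := by
  intro φ
  induction φ with
  | falsum => intro ψ h; cases ψ <;> simp_all [code, Nat.pair_eq_pair]
  | equal t s =>
    intro ψ h
    cases ψ <;> simp_all [code, Nat.pair_eq_pair]
    exact ⟨varIndex_injective h.1, varIndex_injective h.2⟩
  | rel R ts =>
    intro ψ h
    cases ψ with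
    | rel R' ts' =>
      simp only [code, Nat.pair_eq_pair, true_and, Encodable.encode_inj] at h
      obtain ⟨⟨rfl, hR⟩, hts⟩ := h
      obtain rfl := Subtype.ext hR
      have := List.ofFn_injective hts
      congr 1
      funext i
      exact varIndex_injective (congrFun this i)
    | _ => simp_all [code, Nat.pair_eq_pair]
  | imp φ₁ φ₂ h₁ h₂ =>
    intro ψ h
    cases ψ <;> simp only [code, Nat.pair_eq_pair] at h <;> try omega
    obtain ⟨-, h1, h2⟩ := h
    rw [h₁ h1, h₂ h2]
  | all φ ih =>
    intro ψ h
    cases ψ <;> simp only [code, Nat.pair_eq_pair] at h <;> try omega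
    rw [ih h.2.2]

/-- Equivalence over finite (non-empty) structures. -/
def FinEquiv (φ ψ : (voc V).Sentence) : Prop :=
  ∀ (M : Type) [Finite M] [Nonempty M] [(voc V).Structure M], M ⊨ φ ↔ M ⊨ ψ

/-- A sentence is finitely satisfiable if it has a finite (non-empty) model. -/
def FinSat (φ : (voc V).Sentence) : Prop :=
  ∃ (M : Type) (_ : Finite M) (_ : Nonempty M) (_ : (voc V).Structure M), M ⊨ φ

/-- The set `L` of sentences is computable. -/
def IsComputableFragment (L : Set (voc V).Sentence) : Prop :=
  ComputablePred fun c : ℕ => ∃ φ ∈ L, code φ = c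

/-- `L` has the same expressive power as first-order logic over finite structures: over each
vocabulary `τ ⊆ V`, every first-order sentence over `τ` is equivalent, over finite structures, to a
sentence over `τ` that belongs to `L`. (The converse comparison is trivial, as `L` consists of
first-order sentences.) -/
def IsEquiExpressive (L : Set (voc V).Sentence) : Prop :=
  ∀ τ ⊆ V, ∀ φ : (voc V).Sentence, symbols φ ⊆ τ →
    ∃ ψ ∈ L, symbols ψ ⊆ τ ∧ FinEquiv φ ψ

/-- `L` is effectively closed under conjunction: some computable map sends (the Gödel numbers of)
two sentences of `L` to (the Gödel number of) a sentence of `L` equivalent to their conjunction. -/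
def IsEffectivelyClosedUnderConj (L : Set (voc V).Sentence) : Prop :=
  ∃ F : ℕ → ℕ → ℕ, Computable₂ F ∧
    ∀ φ ∈ L, ∀ ψ ∈ L, ∃ χ ∈ L, F (code φ) (code ψ) = code χ ∧ FinEquiv χ (φ ⊓ ψ)

/-- The finite satisfiability problem of `L`, as a set of Gödel numbers. -/
def FinSatProblem (L : Set (voc V).Sentence) (c : ℕ) : Prop :=
  ∃ φ ∈ L, code φ = c ∧ FinSat φ

/-- RE-completeness under computable many-one reductions. -/
def IsREComplete (p : ℕ → Prop) : Prop :=
  REPred p ∧ ∀ q : ℕ → Prop, REPred q → q ≤₀ p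

end FinSatFragment

open FirstOrder

namespace FinSatFragment

variable {V : Set (ℕ × ℕ)}

/-! For enumerability, a finite model together with a list of recorded truth values is a finite
object that can be checked primitive recursively, so finite satisfiability is the existence of a
checkable witness (`finSat_iff`, `rePred_finSatProblem`).

For hardness, fix a universal program `u` (`exists_universal_code`). One sentence `θ` says that a
finite structure records a halting run of `u` whose input is the size of a set `P`, the diagonal of
one relation symbol. Then `u` halts on `n` exactly if `θ` together with "`P` has `n` elements" has a
finite model (`exists_recordsComputation_iff`). Since `θ` does not depend on the input, its
equivalent in `L` may be chosen non-effectively. The counting sentences do depend on `n`, and equal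
expressive power supplies equivalents in `L` without a way of computing them; nor can a search test
equivalence by running through all finite structures.

The way out is to ask for less. `θ` also forces the counting symbol to depend on its first argument
only, so that it acts as a unary predicate. In such structures, the truth of a sentence with no
other symbol depends only on the sizes of `P` and its complement, truncated at the quantifier rank
(`ThresholdEquiv.realize_iff`), and the rank is at most the Gödel number (`quantRank_le_code`).
Hence finitely many small structures decide whether a candidate counts correctly where `θ` holds
(`realize_iff_ncard_eq`). The search for a candidate that passes this test terminates by the
expressive power of `L` over the one-symbol vocabulary (`exists_computable_counting`). Effective
conjunction of `θ` with the sentence found is the reduction; `N` is the number of relations needed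
to record runs of `u`. -/

/-! ### Certificates for the truth of formulas in finite structures -/

/-- A recorded truth value: a formula number, an assignment, and a truth value. -/
abbrev Entry := ℕ × List ℕ × Bool

/-- The entry `t` is justified by the entries of `T` in the structure with universe
`{0, …, m - 1}`, where `atom` evaluates (some of) the atomic formulas. -/
def Justified (atom : ℕ → List ℕ → Option Bool) (m : ℕ) (T : List Entry) (t : Entry) : Prop :=
  (t.1.unpair.1 = 0 ∧ t.2.2 = false) ∨
  (t.1.unpair.1 = 1 ∧
    ((t.2.2 = true ∧ t.2.1.getD t.1.unpair.2.unpair.1 0 = t.2.1.getD t.1.unpair.2.unpair.2 0) ∨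
      (t.2.2 = false ∧
        ¬ t.2.1.getD t.1.unpair.2.unpair.1 0 = t.2.1.getD t.1.unpair.2.unpair.2 0))) ∨
  (t.1.unpair.1 = 2 ∧
    atom t.1.unpair.2.unpair.1
      (((Encodable.decode (α := List ℕ) t.1.unpair.2.unpair.2).getD []).map
        fun i => t.2.1.getD i 0) = some t.2.2) ∨
  (t.1.unpair.1 = 3 ∧ ∃ b₁ b₂ : Bool, (t.1.unpair.2.unpair.1, t.2.1, b₁) ∈ T ∧
    (t.1.unpair.2.unpair.2, t.2.1, b₂) ∈ T ∧ t.2.2 = (!b₁ || b₂)) ∨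
  (t.1.unpair.1 = 4 ∧ t.2.2 = true ∧
    ∀ x < m, (t.1.unpair.2.unpair.2, t.2.1 ++ [x], true) ∈ T) ∨
  (t.1.unpair.1 = 4 ∧ t.2.2 = false ∧
    ∃ x < m, (t.1.unpair.2.unpair.2, t.2.1 ++ [x], false) ∈ T)

theorem Justified.mono {atom : ℕ → List ℕ → Option Bool} {m : ℕ} {T T' : List Entry} {t : Entry}
    (h : Justified atom m T t) (hT : T ⊆ T') : Justified atom m T' t := by
  rcases h with h | h | h | ⟨h0, b₁, b₂, h1, h2, h3⟩ | ⟨h0, h1, h2⟩ | ⟨h0, h1, x, hx, h2⟩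
  · exact .inl h
  · exact .inr (.inl h)
  · exact .inr (.inr (.inl h))
  · exact .inr (.inr (.inr (.inl ⟨h0, b₁, b₂, hT h1, hT h2, h3⟩)))
  · exact .inr (.inr (.inr (.inr (.inl ⟨h0, h1, fun x hx => hT (h2 x hx)⟩))))
  · exact .inr (.inr (.inr (.inr (.inr ⟨h0, h1, x, hx, hT h2⟩))))

/-- All entries of `T` are justified. -/
def Valid (atom : ℕ → List ℕ → Option Bool) (m : ℕ) (T : List Entry) : Prop :=
  ∀ t ∈ T, Justified atom m T t

theorem getD_ofFn {n m : ℕ} (v : Fin n → Fin m) (i : Fin n) :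
    (List.ofFn fun j => (v j : ℕ)).getD i 0 = v i := by
  simp [List.getD_eq_getElem?_getD]

theorem getD_varIndex {n m : ℕ} (v : Fin n → Fin m) (t : (voc V).Term (Empty ⊕ Fin n))
    [(voc V).Structure (Fin m)] :
    (List.ofFn fun j => (v j : ℕ)).getD (varIndex t) 0 = t.realize (Sum.elim default v) := by
  match t with
  | .var (.inl e) => exact e.elim
  | .func f _ => exact Empty.elim f
  | .var (.inr i) => exact getD_ofFn v i

theorem ofFn_snoc {n m : ℕ} (v : Fin n → Fin m) (x : Fin m) :
    (List.ofFn fun j => ((Fin.snoc v x : Fin (n + 1) → Fin m) j : ℕ)) =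
      (List.ofFn fun j => (v j : ℕ)) ++ [(x : ℕ)] := by
  rw [List.ofFn_succ']
  simp

theorem map_getD_args {n m k : ℕ} (v : Fin n → Fin m)
    (ts : Fin k → (voc V).Term (Empty ⊕ Fin n)) [(voc V).Structure (Fin m)] :
    ((Encodable.decode (α := List ℕ)
      (Encodable.encode (List.ofFn fun i => varIndex (ts i)))).getD []).map
        (fun i => (List.ofFn fun j => (v j : ℕ)).getD i 0) =
      List.ofFn fun i => (((ts i).realize (Sum.elim default v) : Fin m) : ℕ) := by
  rw [Encodable.encodek, Option.getD_some, List.map_ofFn]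
  congr 1
  funext i
  exact getD_varIndex v (ts i)

/-- A certificate never short-circuits: an implication needs values for both sides, and a quantifier
needs at least one instance because `0 < m`. Every atomic subformula is therefore evaluated, so an
`atom` undefined outside `τ` makes the certificate witness `symbols φ ⊆ τ` as well as the truth
value. -/
theorem Valid.sound {m : ℕ} (hm : 0 < m) [(voc V).Structure (Fin m)]
    {atom : ℕ → List ℕ → Option Bool} {τ : Set (ℕ × ℕ)} {T : List Entry}
    (hT : Valid atom m T)
    (hatom : ∀ (k : ℕ) (R : (voc V).Relations k) (xs : Fin k → Fin m) (b : Bool),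
      atom (Nat.pair k R.1) (List.ofFn fun i => (xs i : ℕ)) = some b →
        (k, R.1) ∈ τ ∧ (b = true ↔ Language.Structure.RelMap R xs))
    {n : ℕ} (φ : (voc V).BoundedFormula Empty n) (v : Fin n → Fin m) (b : Bool)
    (h : (code φ, (List.ofFn fun j => (v j : ℕ)), b) ∈ T) :
    symbols φ ⊆ τ ∧ (b = true ↔ φ.Realize default v) := by
  induction φ generalizing b with
  | falsum =>
    have := hT _ h
    simp only [Justified, code, Nat.unpair_pair] at this
    simp at this
    simp [symbols, this, Language.BoundedFormula.Realize]
  | equal t s =>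
    have := hT _ h
    simp only [Justified, code, Nat.unpair_pair, getD_varIndex] at this
    simp at this
    refine ⟨Set.empty_subset _, ?_⟩
    simp only [Language.BoundedFormula.Realize]
    cases b <;> simp_all [Fin.ext_iff]
  | rel R ts =>
    have := hT _ h
    simp only [Justified, code, Nat.unpair_pair, map_getD_args] at this
    simp at this
    obtain ⟨h1, h2⟩ := hatom _ _ _ _ this
    exact ⟨by simpa [symbols] using h1, h2⟩
  | imp φ ψ ihφ ihψ =>
    have := hT _ h
    simp only [Justified, code, Nat.unpair_pair] at this
    simp only [OfNat.ofNat_ne_zero, false_and, Nat.reduceEqDiff, OfNat.ofNat_ne_one, true_and,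
      or_false, false_or] at this
    obtain ⟨b₁, b₂, h1, h2, rfl⟩ := this
    obtain ⟨h3, h4⟩ := ihφ _ _ h1
    obtain ⟨h5, h6⟩ := ihψ _ _ h2
    refine ⟨Set.union_subset h3 h5, ?_⟩
    rw [Language.BoundedFormula.realize_imp, ← h4, ← h6]
    cases b₁ <;> cases b₂ <;> simp
  | all φ ih =>
    have := hT _ h
    simp only [Justified, code, Nat.unpair_pair] at this
    simp only [OfNat.ofNat_ne_zero, false_and, Nat.reduceEqDiff, OfNat.ofNat_ne_one, true_and,
      false_or] at this
    rcases this with ⟨rfl, h1⟩ | ⟨rfl, x, hx, h1⟩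
    · have h2 : ∀ x : Fin m, _ := fun x => ih (Fin.snoc v x) true
        (by rw [ofFn_snoc]; exact h1 x x.2)
      refine ⟨(h2 ⟨0, hm⟩).1, ?_⟩
      simpa [Language.BoundedFormula.realize_all] using fun x => (h2 x).2
    · have h2 := ih (Fin.snoc v ⟨x, hx⟩) false (by rw [ofFn_snoc]; exact h1)
      refine ⟨h2.1, ?_⟩
      simp only [Bool.false_eq_true, false_iff] at h2 ⊢
      exact fun h3 => h2.2 (h3 _)

-- Certificates for the subformulas can be concatenated, since justification survives enlarging the
-- list (`Justified.mono`); for a quantifier, those of all instances are joined.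
open Classical in
theorem exists_valid {m : ℕ} [(voc V).Structure (Fin m)] {atom : ℕ → List ℕ → Option Bool}
    {n : ℕ} (φ : (voc V).BoundedFormula Empty n)
    (hatom : ∀ (k : ℕ) (R : (voc V).Relations k) (xs : Fin k → Fin m), (k, R.1) ∈ symbols φ →
      atom (Nat.pair k R.1) (List.ofFn fun i => (xs i : ℕ)) =
        some (decide (Language.Structure.RelMap R xs)))
    (v : Fin n → Fin m) :
    ∃ T, Valid atom m T ∧
      (code φ, (List.ofFn fun j => (v j : ℕ)), decide (φ.Realize default v)) ∈ T := by
  have key : ∀ (T : List Entry) (t : Entry), Valid atom m T → Justified atom m T t →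
      ∃ T, Valid atom m T ∧ t ∈ T := fun T t hT ht =>
    ⟨t :: T, fun s hs => by
      rcases List.mem_cons.1 hs with rfl | hs
      · exact ht.mono (List.subset_cons_self _ _)
      · exact (hT s hs).mono (List.subset_cons_self _ _), List.mem_cons_self⟩
  have nil : Valid atom m [] := fun t ht => by simp at ht
  induction φ with
  | falsum =>
    refine key [] _ nil (.inl ?_)
    simp only [code, Nat.unpair_pair, true_and]
    exact decide_eq_false id
  | equal t s =>
    refine key [] _ nil (.inr (.inl ?_))
    simp only [code, Nat.unpair_pair, getD_varIndex, Language.BoundedFormula.Realize]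
    simp [Fin.ext_iff]
    tauto
  | rel R ts =>
    refine key [] _ nil (.inr (.inr (.inl ?_)))
    simp only [code, Nat.unpair_pair, map_getD_args, true_and]
    exact hatom _ _ _ rfl
  | imp φ ψ ihφ ihψ =>
    obtain ⟨T₁, h1, h2⟩ := ihφ (fun k R xs h => hatom k R xs (.inl h)) v
    obtain ⟨T₂, h3, h4⟩ := ihψ (fun k R xs h => hatom k R xs (.inr h)) v
    refine key (T₁ ++ T₂) _ ?_ (.inr (.inr (.inr (.inl ?_))))
    · intro t ht
      rcases List.mem_append.1 ht with ht | ht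
      · exact (h1 t ht).mono (List.subset_append_left _ _)
      · exact (h3 t ht).mono (List.subset_append_right _ _)
    · simp only [code, Nat.unpair_pair, true_and]
      refine ⟨_, _, List.mem_append_left _ h2, List.mem_append_right _ h4, ?_⟩
      by_cases hφ : φ.Realize default v <;> simp [Language.BoundedFormula.realize_imp, hφ]
  | all φ ih =>
    choose T h1 h2 using fun x : Fin m => ih hatom (Fin.snoc v x)
    refine key ((List.finRange m).flatMap T) _ ?_ ?_
    · intro t ht
      obtain ⟨x, -, hx⟩ := List.mem_flatMap.1 ht
      exact (h1 x t hx).mono fun s hs => List.mem_flatMap.2 ⟨x, List.mem_finRange x, hs⟩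
    · simp only [ofFn_snoc] at h2
      by_cases hφ : ∀ x : Fin m, φ.Realize default (Fin.snoc v x : Fin _ → Fin m)
      · refine .inr (.inr (.inr (.inr (.inl ?_))))
        simp only [code, Nat.unpair_pair, true_and]
        refine ⟨decide_eq_true hφ, fun x hx => List.mem_flatMap.2
          ⟨⟨x, hx⟩, List.mem_finRange _, ?_⟩⟩
        have := h2 ⟨x, hx⟩
        rwa [decide_eq_true (hφ ⟨x, hx⟩)] at this
      · refine .inr (.inr (.inr (.inr (.inr ?_))))
        simp only [code, Nat.unpair_pair, true_and]
        refine ⟨decide_eq_false hφ, ?_⟩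
        push Not at hφ
        obtain ⟨x, hx⟩ := hφ
        refine ⟨x, x.2, List.mem_flatMap.2 ⟨x, List.mem_finRange _, ?_⟩⟩
        have := h2 x
        rwa [decide_eq_false hx] at this

/-! ### Checking certificates is primitive recursive -/

section Primrec

variable {α : Type} [Primcodable α]

theorem primrecPred_mem {β : Type} [Primcodable β] {f : α → β} {T : α → List β}
    (hf : Primrec f) (hT : Primrec T) : PrimrecPred fun a => f a ∈ T a :=
  ((PrimrecRel.exists_mem_list (Primrec.eq (α := β))).comp hT hf).of_eq fun a => by simp

theorem primrecPred_exists_bool {p : α → Bool → Prop} (h : ∀ b, PrimrecPred fun a => p a b) :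
    PrimrecPred fun a => ∃ b, p a b :=
  ((h false).or (h true)).of_eq fun a => by simp [Bool.exists_bool]

theorem primrecPred_forall_lt {f : α → ℕ} {R : ℕ → α → Prop} (hf : Primrec f)
    (hR : PrimrecRel R) : PrimrecPred fun a => ∀ x < f a, R x a :=
  (hR.forall_mem_list.comp (Primrec.list_range.comp hf) Primrec.id).of_eq fun a => by simp

theorem primrecPred_exists_lt {f : α → ℕ} {R : ℕ → α → Prop} (hf : Primrec f)
    (hR : PrimrecRel R) : PrimrecPred fun a => ∃ x < f a, R x a :=
  (hR.exists_mem_list.comp (Primrec.list_range.comp hf) Primrec.id).of_eq fun a => by simp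

theorem primrecPred_justified {atom : α → ℕ → List ℕ → Option Bool} {size : α → ℕ}
    (hatom : Primrec fun q : α × ℕ × List ℕ => atom q.1 q.2.1 q.2.2) (hsize : Primrec size) :
    PrimrecRel fun (t : Entry) (q : α × List Entry) =>
      Justified (atom q.1) (size q.1) q.2 t := by
  have ht : Primrec fun p : Entry × α × List Entry => p.1 := Primrec.fst
  have hp : Primrec fun p : Entry × α × List Entry => p.2.1 := Primrec.fst.comp Primrec.snd
  have hT : Primrec fun p : Entry × α × List Entry => p.2.2 := Primrec.snd.comp Primrec.snd
  have hc := Primrec.unpair.comp (Primrec.fst.comp ht)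
  have htag := Primrec.fst.comp hc
  have hc' := Primrec.unpair.comp (Primrec.snd.comp hc)
  have hl := Primrec.fst.comp hc'
  have hr := Primrec.snd.comp hc'
  have he := Primrec.fst.comp (Primrec.snd.comp ht)
  have hb := Primrec.snd.comp (Primrec.snd.comp ht)
  have tag (i : ℕ) := Primrec.eq.comp htag (Primrec.const i)
  have val (b : Bool) := Primrec.eq.comp hb (Primrec.const b)
  have hequal := Primrec.eq.comp ((Primrec.list_getD (0 : ℕ)).comp he hl)
    ((Primrec.list_getD (0 : ℕ)).comp he hr)
  have hargs : Primrec fun p : Entry × α × List Entry =>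
      ((Encodable.decode (α := List ℕ) p.1.1.unpair.2.unpair.2).getD []).map
        fun i => p.1.2.1.getD i 0 :=
    Primrec.list_map
      (Primrec.option_getD.comp (Primrec.decode.comp hr) (Primrec.const []))
      ((Primrec.list_getD (0 : ℕ)).comp (he.comp Primrec.fst) Primrec.snd).to₂
  have hmem (b : Bool) : PrimrecRel fun (x : ℕ) (p : Entry × α × List Entry) =>
      (p.1.1.unpair.2.unpair.2, p.1.2.1 ++ [x], b) ∈ p.2.2 :=
    primrecPred_mem (α := ℕ × Entry × α × List Entry)
      ((hr.comp Primrec.snd).pair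
        ((Primrec.list_append.comp (he.comp Primrec.snd)
          (Primrec.list_cons.comp Primrec.fst (Primrec.const []))).pair (Primrec.const b)))
      (hT.comp Primrec.snd)
  refine PrimrecPred.or ((tag 0).and (val false)) (.or ((tag 1).and (.or ((val true).and hequal)
    ((val false).and hequal.not))) (.or ((tag 2).and ?_) (.or ((tag 3).and ?_)
    (.or ((tag 4).and ((val true).and ?_)) ((tag 4).and ((val false).and ?_))))))
  · exact Primrec.eq.comp (hatom.comp (hp.pair (hl.pair hargs))) (Primrec.option_some.comp hb)
  · exact primrecPred_exists_bool fun b₁ => primrecPred_exists_bool fun b₂ =>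
      (primrecPred_mem (hl.pair (he.pair (Primrec.const b₁))) hT).and
        ((primrecPred_mem (hr.pair (he.pair (Primrec.const b₂))) hT).and
          (Primrec.eq.comp hb (Primrec.const _)))
  · exact primrecPred_forall_lt (hsize.comp hp) (hmem true)
  · exact primrecPred_exists_lt (hsize.comp hp) (hmem false)

theorem primrecPred_valid {atom : α → ℕ → List ℕ → Option Bool} {size : α → ℕ}
    (hatom : Primrec fun q : α × ℕ × List ℕ => atom q.1 q.2.1 q.2.2) (hsize : Primrec size) :
    PrimrecPred fun q : α × List Entry => Valid (atom q.1) (size q.1) q.2 :=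
  (PrimrecRel.forall_mem_list (primrecPred_justified hatom hsize)).comp Primrec.snd Primrec.id

end Primrec

/-! ### Recursive enumerability and effective search -/

section Search

variable {α β : Type} [Primcodable β]

/-- The search for the first witness of a computable relation. -/
def witnessSearch (R : α → β → Bool) (a : α) : Part β :=
  Nat.rfindOpt fun k => (Encodable.decode (α := β) k).bind fun b => bif R a b then some b else none

theorem mem_witnessSearch {R : α → β → Bool} {a : α} {b : β} (h : b ∈ witnessSearch R a) :
    R a b = true := by
  obtain ⟨k, hk⟩ := Nat.rfindOpt_spec h
  obtain ⟨b', -, hb⟩ := Option.bind_eq_some_iff.1 hk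
  cases h : R a b'
  · simp [h] at hb
  · simp only [h, cond_true, Option.some.injEq] at hb
    rwa [← hb]

theorem witnessSearch_dom {R : α → β → Bool} {a : α} {b : β} (h : R a b = true) :
    (witnessSearch R a).Dom :=
  Nat.rfindOpt_dom.2 ⟨Encodable.encode b, b, by simp [h]⟩

theorem partrec_witnessSearch [Primcodable α] {R : α → β → Bool} (hR : Computable₂ R) :
    Partrec (witnessSearch R) := by
  refine Partrec.rfindOpt (Computable.option_bind (Computable.decode.comp Computable.snd) ?_)
  exact Computable.cond (hR.comp (Computable.fst.comp Computable.fst) Computable.snd)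
    (Computable.option_some.comp Computable.snd) (Computable.const none)

theorem ComputablePred.exists_bool [Primcodable α] {p : α × β → Prop} (h : ComputablePred p) :
    ∃ R : α → β → Bool, Computable₂ R ∧ ∀ a b, R a b = true ↔ p (a, b) := by
  obtain ⟨_, h⟩ := h
  exact ⟨fun a b => decide (p (a, b)), h, fun a b => by simp⟩

theorem rePred_exists [Primcodable α] {p : α × β → Prop} (h : ComputablePred p) :
    REPred fun a => ∃ b, p (a, b) := by
  obtain ⟨R, hR, hp⟩ := ComputablePred.exists_bool h
  refine ((partrec_witnessSearch hR).dom_re).of_eq fun a => ?_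
  constructor
  · intro h
    exact ⟨_, (hp _ _).1 (mem_witnessSearch (Part.get_mem h))⟩
  · rintro ⟨b, hb⟩
    exact witnessSearch_dom ((hp _ _).2 hb)

/-- Unbounded search is total once a witness is known to exist for each input; the existence proof
itself need not be effective. -/
theorem exists_computable_choice [Primcodable α] {p : α × β → Prop} (h : ComputablePred p)
    (hp : ∀ a, ∃ b, p (a, b)) : ∃ g : α → β, Computable g ∧ ∀ a, p (a, g a) := by
  obtain ⟨R, hR, hRp⟩ := ComputablePred.exists_bool h
  have hdom : ∀ a, (witnessSearch R a).Dom := fun a =>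
    witnessSearch_dom ((hRp _ _).2 (hp a).choose_spec)
  exact ⟨fun a => (witnessSearch R a).get (hdom a),
    (partrec_witnessSearch hR).of_eq_tot fun a => Part.get_mem (hdom a),
    fun a => (hRp _ _).1 (mem_witnessSearch (Part.get_mem (hdom a)))⟩

theorem ComputablePred.inter [Primcodable α] {p q : α → Prop} (hp : ComputablePred p)
    (hq : ComputablePred q) : ComputablePred fun a => p a ∧ q a := by
  obtain ⟨_, h⟩ := hp
  obtain ⟨_, h'⟩ := hq
  exact ⟨fun a => inferInstance, (Primrec.and.to_comp.comp h h').of_eq fun a => by simp⟩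

theorem ComputablePred.comp [Primcodable α] {p : β → Prop} {f : α → β} (hp : ComputablePred p)
    (hf : Computable f) : ComputablePred fun a => p (f a) := by
  obtain ⟨_, h⟩ := hp
  exact ⟨fun a => inferInstance, h.comp hf⟩

end Search

/-! ### The finite satisfiability problem is recursively enumerable -/

theorem finite_symbols {n : ℕ} (φ : (voc V).BoundedFormula Empty n) : (symbols φ).Finite := by
  induction φ with
  | falsum => exact Set.finite_empty
  | equal => exact Set.finite_empty
  | rel => exact Set.finite_singleton _
  | imp _ _ h₁ h₂ => exact h₁.union h₂
  | all _ h => exact h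

/-- The evaluation of atomic formulas given by a list of all true atomic facts. -/
def listAtom (A : List (ℕ × List ℕ)) (s : ℕ) (args : List ℕ) : Option Bool :=
  some (decide ((s, args) ∈ A))

theorem primrec_listAtom :
    Primrec fun q : List (ℕ × List ℕ) × ℕ × List ℕ => listAtom q.1 q.2.1 q.2.2 :=
  Primrec.option_some.comp (primrecPred_mem (β := ℕ × List ℕ) Primrec.snd Primrec.fst).decide

/-- The structure on `{0, …, m - 1}` described by a list of all true atomic facts. -/
@[reducible]
def listStructure (V : Set (ℕ × ℕ)) (A : List (ℕ × List ℕ)) (m : ℕ) :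
    (voc V).Structure (Fin m) where
  funMap f := Empty.elim f
  RelMap {k} R xs := (Nat.pair k R.1, List.ofFn fun i => (xs i : ℕ)) ∈ A

/-- A finite model of the formula with number `c`: its size, its true atomic facts, and a
certificate for the truth of the formula. -/
def IsModelCertificate (c : ℕ) (w : (ℕ × List (ℕ × List ℕ)) × List Entry) : Prop :=
  0 < w.1.1 ∧ Valid (listAtom w.1.2) w.1.1 w.2 ∧ (c, [], true) ∈ w.2

theorem primrecRel_isModelCertificate : PrimrecRel IsModelCertificate :=
  (Primrec.nat_lt.comp (Primrec.const 0)
    (Primrec.fst.comp (Primrec.fst.comp Primrec.snd))).and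
  (((primrecPred_valid (α := ℕ × List (ℕ × List ℕ)) (atom := fun a => listAtom a.2)
    (size := Prod.fst)
    (primrec_listAtom.comp ((Primrec.snd.comp Primrec.fst).pair Primrec.snd))
    Primrec.fst).comp Primrec.snd).and
  (primrecPred_mem (Primrec.fst.pair (Primrec.const _)) (Primrec.snd.comp Primrec.snd)))

theorem finSat_iff (φ : (voc V).Sentence) :
    FinSat φ ↔ ∃ w, IsModelCertificate (code φ) w := by
  constructor
  · rintro ⟨M, _, _, _, hφ⟩
    obtain ⟨m, ⟨e⟩⟩ := Finite.exists_equiv_fin M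
    let S : (voc V).Structure (Fin m) := e.inducedStructure
    have hφ' : Fin m ⊨ φ := (Language.StrongHomClass.realize_sentence (e.inducedStructureEquiv (L := voc V)) φ).1 hφ
    -- The vocabulary may be infinite; keeping only facts about symbols of `φ` makes the list of
    -- true facts finite.
    have hfin : {s : ℕ × List ℕ | ∃ (k : ℕ) (R : (voc V).Relations k) (xs : Fin k → Fin m),
        (k, R.1) ∈ symbols φ ∧ Language.Structure.RelMap R xs ∧
          (Nat.pair k R.1, List.ofFn fun i => (xs i : ℕ)) = s}.Finite := by
      refine ((finite_symbols φ).biUnion (t := fun s => Set.range fun xs : Fin s.1 → Fin m =>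
        (Nat.pair s.1 s.2, List.ofFn fun i => (xs i : ℕ))) fun s _ => Set.finite_range _).subset ?_
      rintro _ ⟨k, R, xs, hR, -, rfl⟩
      exact Set.mem_biUnion hR ⟨xs, rfl⟩
    classical
    obtain ⟨T, hT, hmem⟩ := exists_valid (atom := listAtom hfin.toFinset.toList) φ
      (fun k R xs hR => by
        simp only [listAtom, Finset.mem_toList, Set.Finite.mem_toFinset, Set.mem_ofPred_eq,
          Option.some.injEq, decide_eq_decide]
        constructor
        · rintro ⟨k', R', xs', -, h, h'⟩
          simp only [Prod.mk.injEq, Nat.pair_eq_pair] at h'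
          obtain ⟨⟨rfl, hR'⟩, hxs⟩ := h'
          obtain rfl := Subtype.ext hR'
          have := List.ofFn_injective hxs
          obtain rfl : xs' = xs := funext fun i => Fin.ext (congrFun this i)
          exact h
        · exact fun h => ⟨k, R, xs, hR, h, rfl⟩) default
    refine ⟨((m, hfin.toFinset.toList), T), ?_, hT, ?_⟩
    · exact Fin.pos_iff_nonempty.2 (e.nonempty_congr.1 inferInstance)
    · rw [List.ofFn_zero] at hmem
      convert hmem
      exact (decide_eq_true hφ').symm
  · rintro ⟨⟨⟨m, A⟩, T⟩, hm, hT, hmem⟩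
    let _ := listStructure V A m
    refine ⟨Fin m, inferInstance, Fin.pos_iff_nonempty.1 hm, listStructure V A m, ?_⟩
    refine ((hT.sound (τ := Set.univ) hm (fun k R xs b h => ⟨trivial, ?_⟩) φ default true
      (by rw [List.ofFn_zero]; exact hmem)).2.1 rfl)
    simp only [listAtom, Option.some.injEq] at h
    rw [← h, decide_eq_true_iff]
    rfl

theorem rePred_finSatProblem {L : Set (voc V).Sentence} (hL : IsComputableFragment L) :
    REPred (FinSatProblem L) := by
  have h : ComputablePred fun q : ℕ × (ℕ × List (ℕ × List ℕ)) × List Entry =>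
      (∃ φ ∈ L, code φ = q.1) ∧ IsModelCertificate q.1 q.2 :=
 ComputablePred.inter
      (ComputablePred.comp (p := fun c => ∃ φ ∈ L, code φ = c) hL Computable.fst)
      primrecRel_isModelCertificate.computablePred
  refine (rePred_exists h).of_eq fun c => ?_
  constructor
  · rintro ⟨w, ⟨φ, hφ, rfl⟩, hw⟩
    exact ⟨φ, hφ, rfl, (finSat_iff φ).2 ⟨w, hw⟩⟩
  · rintro ⟨φ, hφ, rfl, h⟩
    obtain ⟨w, hw⟩ := (finSat_iff φ).1 h
    exact ⟨w, ⟨φ, hφ, rfl⟩, hw⟩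

/-! ### Searching for a sentence that counts the elements of one colour -/

/-- The structure in which each atomic formula says that its first argument is in `P`. -/
@[reducible]
def colourStructure (V : Set (ℕ × ℕ)) {M : Type} (P : M → Prop) : (voc V).Structure M where
  funMap f := Empty.elim f
  RelMap {k} _ xs := ∃ h : 0 < k, P (xs ⟨0, h⟩)

/-- The evaluation of the atomic formulas with the symbol number `s` in a colour structure in which
the first `a` elements are coloured. -/
def colourAtom (s : ℕ) (p : ℕ × ℕ) (s' : ℕ) (args : List ℕ) : Option Bool :=
  bif decide (s' = s) then some (decide (args.getD 0 0 < p.1)) else none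

theorem primrec_colourAtom (s : ℕ) :
    Primrec fun q : (ℕ × ℕ) × ℕ × List ℕ => colourAtom s q.1 q.2.1 q.2.2 :=
  Primrec.cond
    (Primrec.eq.comp (Primrec.fst.comp Primrec.snd) (Primrec.const s)).decide
    (Primrec.option_some.comp (Primrec.nat_lt.comp
      ((Primrec.list_getD 0).comp (Primrec.snd.comp Primrec.snd) (Primrec.const 0))
      (Primrec.fst.comp Primrec.fst)).decide)
    (Primrec.const none)

/-- The value `none` on all other symbols is what lets a certificate rule out foreign symbols, so
the search needs no separate syntactic test. -/
theorem colourAtom_pair {k i : ℕ} (hk : 0 < k) (hi : (k, i) ∈ V) (a m : ℕ) (l : ℕ)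
    (R : (voc V).Relations l) (xs : Fin l → Fin m) (b : Bool) :
    colourAtom (Nat.pair k i) (a, m) (Nat.pair l R.1) (List.ofFn fun j => (xs j : ℕ)) = some b ↔
      (l, R.1) ∈ ({(k, i)} : Set (ℕ × ℕ)) ∧
        (b = true ↔ (colourStructure V fun x : Fin m => (x : ℕ) < a).RelMap R xs) := by
  simp only [colourAtom, Nat.pair_eq_pair, Set.mem_singleton_iff, Prod.mk.injEq]
  by_cases h : l = k ∧ R.1 = i
  · obtain ⟨rfl, h'⟩ := h
    have h0 := getD_ofFn xs ⟨0, hk⟩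
    simp only at h0
    have hR : (colourStructure V fun x : Fin m => (x : ℕ) < a).RelMap R xs ↔
        (xs ⟨0, hk⟩ : ℕ) < a := ⟨fun h => h.2, fun h => ⟨hk, h⟩⟩
    simp only [hR, h', h0, and_self, decide_true, cond_true, Option.some.injEq, true_and]
    by_cases hx : (xs ⟨0, hk⟩ : ℕ) < a <;> cases b <;> simp [hx]
  · simp [h]

/-- A sentence number and certificates showing that it is the number of a sentence that holds in
the small colour structures exactly if the number of coloured elements is `n`. -/
def IsCountCertificate (s n : ℕ) (w : ℕ × List (List Entry)) : Prop :=
  ∀ a < n + w.1 + 2, ∀ b < n + w.1 + 2, a + b = 0 ∨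
    ∃ T ∈ w.2, Valid (colourAtom s (a, a + b)) (a + b) T ∧ (w.1, [], decide (a = n)) ∈ T

theorem primrecRel_isCountCertificate (s : ℕ) : PrimrecRel (IsCountCertificate s) := by
  have hbd : Primrec fun p : ℕ × ℕ × List (List Entry) => p.1 + p.2.1 + 2 :=
    Primrec.nat_add.comp (Primrec.nat_add.comp Primrec.fst (Primrec.fst.comp Primrec.snd))
      (Primrec.const 2)
  refine primrecPred_forall_lt hbd ?_
  refine primrecPred_forall_lt (hbd.comp Primrec.snd) ?_
  have ha : Primrec fun q : ℕ × ℕ × ℕ × ℕ × List (List Entry) => q.2.1 :=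
    Primrec.fst.comp Primrec.snd
  have hab : Primrec fun q : ℕ × ℕ × ℕ × ℕ × List (List Entry) => q.2.1 + q.1 :=
    Primrec.nat_add.comp ha Primrec.fst
  refine PrimrecPred.or (Primrec.eq.comp hab (Primrec.const 0)) ?_
  have hw := Primrec.snd.comp (Primrec.snd.comp (Primrec.snd (α := ℕ)
    (β := ℕ × ℕ × ℕ × List (List Entry))))
  have hn := Primrec.fst.comp (Primrec.snd.comp (Primrec.snd (α := ℕ)
    (β := ℕ × ℕ × ℕ × List (List Entry))))
  have hrel : PrimrecRel fun (T : List Entry) (q : ℕ × ℕ × ℕ × ℕ × List (List Entry)) =>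
      Valid (colourAtom s (q.2.1, q.2.1 + q.1)) (q.2.1 + q.1) T ∧
        (q.2.2.2.1, [], decide (q.2.1 = q.2.2.1)) ∈ T :=
    PrimrecPred.and
      ((primrecPred_valid (α := ℕ × ℕ) (primrec_colourAtom s) Primrec.snd).comp
        (((ha.pair hab).comp Primrec.snd).pair Primrec.fst))
      (primrecPred_mem (((Primrec.fst.comp hw).comp Primrec.snd).pair
        ((Primrec.const []).pair ((Primrec.eq.comp ha hn).decide.comp Primrec.snd))) Primrec.fst)
  exact hrel.exists_mem_list.comp (Primrec.snd.comp hw) Primrec.id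

/-- The test is bounded in terms of `n` and the candidate's number, so it is decidable. The search
accepts any sentence that passes, which need not be the one that `hex` provides to make it
terminate. -/
theorem exists_computable_counting {L : Set (voc V).Sentence} (hL : IsComputableFragment L)
    {k i : ℕ} (hk : 0 < k) (hi : (k, i) ∈ V)
    (hex : ∀ n : ℕ, ∃ ψ ∈ L, symbols ψ ⊆ {(k, i)} ∧ ∀ a b : ℕ, 0 < a + b →
      (@Language.Sentence.Realize _ (Fin (a + b))
        (colourStructure V fun x => (x : ℕ) < a) ψ ↔ a = n)) :
    ∃ g : ℕ → ℕ, Computable g ∧ ∀ n, ∃ ψ ∈ L, code ψ = g n ∧ symbols ψ ⊆ {(k, i)} ∧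
      ∀ a < n + code ψ + 2, ∀ b < n + code ψ + 2, 0 < a + b →
        (@Language.Sentence.Realize _ (Fin (a + b))
          (colourStructure V fun x => (x : ℕ) < a) ψ ↔ a = n) := by
  have h : ComputablePred fun q : ℕ × ℕ × List (List Entry) =>
      (∃ φ ∈ L, code φ = q.2.1) ∧ IsCountCertificate (Nat.pair k i) q.1 q.2 :=
    ComputablePred.inter
      (ComputablePred.comp (p := fun c => ∃ φ ∈ L, code φ = c) hL
        (Computable.fst.comp Computable.snd))
      (primrecRel_isCountCertificate _).computablePred
  obtain ⟨g, hg, hgp⟩ := exists_computable_choice h fun n => by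
    obtain ⟨ψ, hψL, hψ, hψn⟩ := hex n
    have hT : ∀ p : ℕ × ℕ, 0 < p.1 + p.2 → ∃ T,
        Valid (colourAtom (Nat.pair k i) (p.1, p.1 + p.2)) (p.1 + p.2) T ∧
          (code ψ, [], decide (p.1 = n)) ∈ T := by
      classical
      rintro ⟨a, b⟩ hab
      let _ := colourStructure V fun x : Fin (a + b) => (x : ℕ) < a
      obtain ⟨T, hT, hm⟩ := exists_valid (atom := colourAtom (Nat.pair k i) (a, a + b)) ψ
        (fun l R xs hR => (colourAtom_pair hk hi _ _ _ _ _ _).2 ⟨hψ hR, by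
          rw [decide_eq_true_iff]⟩) default
      refine ⟨T, hT, ?_⟩
      rw [List.ofFn_zero] at hm
      convert hm
      exact (hψn a b hab).symm
    choose! T hT using hT
    refine ⟨(code ψ, (List.range (n + code ψ + 2)).flatMap fun a =>
      (List.range (n + code ψ + 2)).map fun b => T (a, b)), ⟨ψ, hψL, rfl⟩, ?_⟩
    intro a ha b hb
    rcases Nat.eq_zero_or_pos (a + b) with h0 | h0
    · exact .inl h0
    · refine .inr ⟨T (a, b), ?_, hT _ h0⟩
      simp only [List.mem_flatMap, List.mem_range, List.mem_map]
      exact ⟨a, ha, b, hb, rfl⟩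
  refine ⟨fun n => (g n).1, Computable.fst.comp hg, fun n => ?_⟩
  obtain ⟨⟨ψ, hψL, hψ⟩, hcert⟩ := hgp n
  simp only at hψ hcert
  have key : ∀ a < n + code ψ + 2, ∀ b < n + code ψ + 2, 0 < a + b →
      symbols ψ ⊆ {(k, i)} ∧ (@Language.Sentence.Realize _ (Fin (a + b))
          (colourStructure V fun x => (x : ℕ) < a) ψ ↔ a = n) := by
    intro a ha b hb hab
    rw [hψ] at ha hb
    obtain h0 | ⟨T, -, hT, hm⟩ := hcert a ha b hb
    · omega
    · let _ := colourStructure V fun x : Fin (a + b) => (x : ℕ) < a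
      have := hT.sound (τ := {(k, i)}) hab
        (fun l R xs b' hb' => (colourAtom_pair hk hi _ _ _ _ _ _).1 hb') ψ default
        (decide (a = n)) (by rw [List.ofFn_zero, hψ]; exact hm)
      rw [decide_eq_true_iff] at this
      exact ⟨this.1, this.2.symm⟩
  -- Any nonempty tested structure yields the bound on the symbols; a single uncoloured point is
  -- always within range.
  exact ⟨ψ, hψL, hψ, (key 0 (by omega) 1 (by omega) (by omega)).1,
    fun a ha b hb hab => (key a ha b hb hab).2⟩

/-! ### Threshold equivalence of coloured sets -/

/-- The quantifier rank of a formula. -/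
def quantRank : {n : ℕ} → (voc V).BoundedFormula Empty n → ℕ
  | _, .falsum => 0
  | _, .equal _ _ => 0
  | _, .rel _ _ => 0
  | _, .imp φ ψ => max (quantRank φ) (quantRank ψ)
  | _, .all φ => quantRank φ + 1

/-- This makes the threshold for testing a candidate readable from its Gödel number alone. -/
theorem quantRank_le_code {n : ℕ} (φ : (voc V).BoundedFormula Empty n) :
    quantRank φ ≤ code φ := by
  induction φ with
  | falsum => exact Nat.zero_le _
  | equal => exact Nat.zero_le _
  | rel => exact Nat.zero_le _
  | imp φ ψ h₁ h₂ =>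
    have h3 := Nat.right_le_pair 3 (Nat.pair (code φ) (code ψ))
    have h4 := Nat.right_le_pair (code φ) (code ψ)
    have h5 := Nat.left_le_pair (code φ) (code ψ)
    simp only [quantRank, code]
    omega
  | @all n φ h =>
    have h3 := Nat.add_le_pair 4 (Nat.pair n (code φ))
    have h4 := Nat.right_le_pair n (code φ)
    simp only [quantRank, code]
    omega

/-- The relation symbol `(k, i)`. -/
abbrev relSym {k i : ℕ} (hi : (k, i) ∈ V) : (voc V).Relations k := ⟨i, hi⟩

theorem exists_eq_var {n : ℕ} (t : (voc V).Term (Empty ⊕ Fin n)) : ∃ j, t = .var (.inr j) := by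
  match t with
  | .var (.inl e) => exact e.elim
  | .func f _ => exact Empty.elim f
  | .var (.inr j) => exact ⟨j, rfl⟩

section Colour

variable {M M' : Type}

/-- The elements of colour `c` that do not occur in `v`. -/
def freshOfColour (P : M → Prop) (c : Prop) {n : ℕ} (v : Fin n → M) : Set M :=
  {x | (P x ↔ c) ∧ x ∉ Set.range v}

theorem mem_freshOfColour {P : M → Prop} {c : Prop} {n : ℕ} {v : Fin n → M} {x : M} :
    x ∈ freshOfColour P c v ↔ (P x ↔ c) ∧ x ∉ Set.range v := Iff.rfl

theorem freshOfColour_snoc (P : M → Prop) (c : Prop) {n : ℕ} (v : Fin n → M) (x : M) :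
    freshOfColour P c (Fin.snoc v x : Fin (n + 1) → M) = freshOfColour P c v \ {x} := by
  ext y
  simp only [mem_freshOfColour, Set.mem_sdiff, Set.mem_singleton_iff, Set.mem_range, not_exists,
    Fin.forall_fin_succ', Fin.snoc_castSucc, Fin.snoc_last]
  tauto

/-- The tuples `v` and `v'` have the same equality type and colours, and up to the threshold `K`
the same numbers of further elements of each colour. -/
structure ThresholdEquiv (P : M → Prop) (P' : M' → Prop) (K : ℕ) {n : ℕ} (v : Fin n → M)
    (v' : Fin n → M') : Prop where
  eq_iff : ∀ i j, v i = v j ↔ v' i = v' j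
  colour_iff : ∀ i, P (v i) ↔ P' (v' i)
  min_ncard : ∀ c, min K (freshOfColour P c v).ncard = min K (freshOfColour P' c v').ncard

variable {P : M → Prop} {P' : M' → Prop} {K n : ℕ} {v : Fin n → M} {v' : Fin n → M'}

theorem ThresholdEquiv.symm (h : ThresholdEquiv P P' K v v') : ThresholdEquiv P' P K v' v :=
  ⟨fun i j => (h.eq_iff i j).symm, fun i => (h.colour_iff i).symm, fun c => (h.min_ncard c).symm⟩

theorem ThresholdEquiv.mono (h : ThresholdEquiv P P' K v v') {J : ℕ} (hJ : J ≤ K) :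
    ThresholdEquiv P P' J v v' :=
  ⟨h.eq_iff, h.colour_iff, fun c => by have := h.min_ncard c; omega⟩

/-- This is the forth move of the Ehrenfeucht–Fraïssé game: a repeated element is answered by its
partner, a fresh one by a fresh element of the same colour, at the cost of one unit of threshold. -/
theorem ThresholdEquiv.forth [Finite M] [Finite M'] (h : ThresholdEquiv P P' (K + 1) v v')
    (x : M) : ∃ x', ThresholdEquiv P P' K (Fin.snoc v x : Fin (n + 1) → M)
      (Fin.snoc v' x' : Fin (n + 1) → M') := by
  by_cases hx : x ∈ Set.range v
  · obtain ⟨i, rfl⟩ := hx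
    refine ⟨v' i, ?_, ?_, ?_⟩
    · simp only [Fin.forall_fin_succ', Fin.snoc_castSucc, Fin.snoc_last, h.eq_iff]
      simp
    · simp only [Fin.forall_fin_succ', Fin.snoc_castSucc, Fin.snoc_last]
      exact ⟨h.colour_iff, h.colour_iff i⟩
    · intro c
      have h1 : v i ∉ freshOfColour P c v := fun h => h.2 ⟨i, rfl⟩
      have h2 : v' i ∉ freshOfColour P' c v' := fun h => h.2 ⟨i, rfl⟩
      rw [freshOfColour_snoc, freshOfColour_snoc, Set.sdiff_singleton_eq_self h1,
        Set.sdiff_singleton_eq_self h2]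
      have := h.min_ncard c
      omega
  -- The threshold `K + 1` is positive, so the truncated counts detect emptiness and a fresh answer
  -- of the right colour exists.
  · have hxm : x ∈ freshOfColour P (P x) v := ⟨Iff.rfl, hx⟩
    have hpos := (Set.ncard_pos (Set.toFinite _)).2 ⟨x, hxm⟩
    have hpos' : 0 < (freshOfColour P' (P x) v').ncard := by
      have := h.min_ncard (P x)
      omega
    obtain ⟨x', hx'm⟩ := (Set.ncard_pos (Set.toFinite _)).1 hpos'
    have hne : ∀ i, v i ≠ x := fun i hi => hx ⟨i, hi⟩
    have hne' : ∀ i, v' i ≠ x' := fun i hi => hx'm.2 ⟨i, hi⟩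
    refine ⟨x', ?_, ?_, ?_⟩
    · simp only [Fin.forall_fin_succ', Fin.snoc_castSucc, Fin.snoc_last]
      simp [h.eq_iff, hne, hne', (hne _).symm, (hne' _).symm]
    · simp only [Fin.forall_fin_succ', Fin.snoc_castSucc, Fin.snoc_last]
      exact ⟨h.colour_iff, hx'm.1.symm⟩
    · intro c
      rw [freshOfColour_snoc, freshOfColour_snoc]
      have := h.min_ncard c
      by_cases hc : P x ↔ c
      · obtain rfl := propext hc
        rw [Set.ncard_sdiff_singleton_of_mem hxm, Set.ncard_sdiff_singleton_of_mem hx'm]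
        omega
      · have h1 : x ∉ freshOfColour P c v := fun h => hc h.1
        have h2 : x' ∉ freshOfColour P' c v' := fun h => hc (hx'm.1.symm.trans h.1)
        rw [Set.sdiff_singleton_eq_self h1, Set.sdiff_singleton_eq_self h2]
        omega

/-- Each quantifier is one move of the game, so a threshold of at least the quantifier rank
suffices. Atomic formulas only see the colour of the first argument. -/
theorem ThresholdEquiv.realize_iff [Finite M] [Finite M'] [(voc V).Structure M]
    [(voc V).Structure M'] {k i : ℕ} (hk : 0 < k) (hi : (k, i) ∈ V)
    (hP : ∀ xs : Fin k → M,
      Language.Structure.RelMap (relSym hi) xs ↔ P (xs ⟨0, hk⟩))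
    (hP' : ∀ xs : Fin k → M',
      Language.Structure.RelMap (relSym hi) xs ↔ P' (xs ⟨0, hk⟩))
    (φ : (voc V).BoundedFormula Empty n) (hφ : symbols φ ⊆ {(k, i)}) (hK : quantRank φ ≤ K)
    (h : ThresholdEquiv P P' K v v') : φ.Realize default v ↔ φ.Realize default v' := by
  induction φ generalizing K with
  | falsum => exact Iff.rfl
  | equal t s =>
    obtain ⟨a, rfl⟩ := exists_eq_var t
    obtain ⟨b, rfl⟩ := exists_eq_var s
    exact h.eq_iff a b
  | @rel n l R ts =>
    have hR := hφ (Set.mem_singleton (l, R.1))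
    simp only [Set.mem_singleton_iff, Prod.mk.injEq] at hR
    obtain ⟨rfl, hR⟩ := hR
    obtain rfl : R = relSym hi := Subtype.ext hR
    obtain ⟨a, ha⟩ := exists_eq_var (ts ⟨0, hk⟩)
    refine (hP _).trans (Iff.trans ?_ (hP' _).symm)
    rw [ha]
    exact h.colour_iff a
  | imp φ ψ h₁ h₂ =>
    simp only [quantRank, sup_le_iff] at hK
    exact imp_congr (h₁ (Set.subset_union_left.trans hφ) hK.1 h)
      (h₂ (Set.subset_union_right.trans hφ) hK.2 h)
  | all φ ih =>
    have h' := h.mono hK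
    constructor
    · intro hv x'
      obtain ⟨x, hx⟩ := h'.symm.forth x'
      exact (ih hφ le_rfl hx.symm).1 (hv x)
    · intro hv x
      obtain ⟨x', hx⟩ := h'.forth x
      exact (ih hφ le_rfl hx).2 (hv x')

end Colour

theorem ncard_lt_and_not_lt (a b : ℕ) (c : Prop) :
    (c → {x : Fin (a + b) | (x : ℕ) < a ↔ c}.ncard = a) ∧
      (¬ c → {x : Fin (a + b) | (x : ℕ) < a ↔ c}.ncard = b) := by
  have h1 : {x : Fin (a + b) | (x : ℕ) < a} = Set.range (Fin.castAdd b : Fin a → Fin (a + b)) := by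
    ext x
    exact ⟨fun h => ⟨⟨x, h⟩, rfl⟩, by rintro ⟨y, rfl⟩; exact y.2⟩
  have h2 : {x : Fin (a + b) | ¬ (x : ℕ) < a} =
      Set.range (Fin.natAdd a : Fin b → Fin (a + b)) := by
    ext x
    constructor
    · intro h
      simp only [Set.mem_ofPred_eq, not_lt] at h
      exact ⟨⟨x - a, by omega⟩, by ext; simp; omega⟩
    · rintro ⟨y, rfl⟩
      simp
  constructor
  · intro hc
    simp only [hc, iff_true]
    rw [h1, Set.ncard_range_of_injective (Fin.castAdd_injective a b), Nat.card_fin]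
  · intro hc
    simp only [hc, iff_false]
    rw [h2, Set.ncard_range_of_injective (Fin.natAdd_injective b a), Nat.card_fin]

/-- In structures in which the symbol `(k, i)` depends on its first argument only, a sentence with
no other symbol that counts correctly in small colour structures counts correctly. -/
theorem realize_iff_ncard_eq {M : Type} [Finite M] [Nonempty M] [(voc V).Structure M] {k i : ℕ}
    (hk : 0 < k) (hi : (k, i) ∈ V) {P : M → Prop}
    (hP : ∀ xs : Fin k → M,
      Language.Structure.RelMap (relSym hi) xs ↔ P (xs ⟨0, hk⟩))
    {n : ℕ} (ψ : (voc V).Sentence) (hψ : symbols ψ ⊆ {(k, i)})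
    (hn : ∀ a < n + code ψ + 2, ∀ b < n + code ψ + 2, 0 < a + b →
      (@Language.Sentence.Realize _ (Fin (a + b))
        (colourStructure V fun x => (x : ℕ) < a) ψ ↔ a = n)) :
    M ⊨ ψ ↔ {x | P x}.ncard = n := by
  -- `K` bounds the quantifier rank, and it exceeds `n`, so truncating at `K` does not change
  -- whether a count equals `n`. Truncated counts are below `K + 1`, the range covered by `hn`.
  set K := n + code ψ + 1 with hK
  set a := min K {x | P x}.ncard with ha
  set b := min K {x | ¬ P x}.ncard with hb
  have hab : 0 < a + b := by
    obtain ⟨x⟩ := ‹Nonempty M›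
    by_cases hx : P x
    · have := (Set.ncard_pos (s := {x | P x}) (Set.toFinite _)).2 ⟨x, hx⟩
      omega
    · have := (Set.ncard_pos (s := {x | ¬ P x}) (Set.toFinite _)).2 ⟨x, hx⟩
      omega
  have h1 := hn a (by omega) b (by omega) hab
  let S := colourStructure V fun x : Fin (a + b) => (x : ℕ) < a
  have hequiv : ThresholdEquiv P (fun x : Fin (a + b) => (x : ℕ) < a) K (default : Fin 0 → M)
      default := by
    refine ⟨fun i => i.elim0, fun i => i.elim0, fun c => ?_⟩
    simp only [freshOfColour, Set.range_eq_empty, Set.mem_empty_iff_false, not_false_eq_true,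
      and_true]
    by_cases hc : c
    · rw [(ncard_lt_and_not_lt a b c).1 hc]
      simp only [hc, iff_true]
      omega
    · rw [(ncard_lt_and_not_lt a b c).2 hc]
      simp only [hc, iff_false]
      omega
  have hS : ∀ xs : Fin k → Fin (a + b), Language.Structure.RelMap (relSym hi) xs ↔
      (xs ⟨0, hk⟩ : ℕ) < a := fun xs => ⟨fun h => h.2, fun h => ⟨hk, h⟩⟩
  have h2 := hequiv.realize_iff hk hi hP hS ψ hψ
    ((quantRank_le_code ψ).trans (by omega))
  exact h2.trans (h1.trans (by omega))

/-! ### Uniformly definable relations -/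

/-- A relation on the tuples of finite structures that is defined, uniformly in the structure, by a
formula with symbols in `τ`. -/
def DefinableOver (τ : Set (ℕ × ℕ)) {n : ℕ}
    (A : ∀ (M : Type) [Finite M] [(voc V).Structure M], (Fin n → M) → Prop) : Prop :=
  ∃ φ : (voc V).BoundedFormula Empty n, symbols φ ⊆ τ ∧
    ∀ (M : Type) [Finite M] [(voc V).Structure M] (v : Fin n → M), φ.Realize default v ↔ A M v

namespace DefinableOver

variable {τ : Set (ℕ × ℕ)} {n : ℕ}
  {A B : ∀ (M : Type) [Finite M] [(voc V).Structure M], (Fin n → M) → Prop}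

theorem congr (h : DefinableOver τ A)
    (hAB : ∀ (M : Type) [Finite M] [(voc V).Structure M] (v : Fin n → M), A M v ↔ B M v) :
    DefinableOver τ B := by
  obtain ⟨φ, hφ, h⟩ := h
  exact ⟨φ, hφ, fun M _ _ v => (h M v).trans (hAB M v)⟩

theorem false : DefinableOver (V := V) τ (n := n) fun _ _ _ _ => False :=
  ⟨.falsum, Set.empty_subset _, fun _ _ _ _ => Iff.rfl⟩

theorem imp (hA : DefinableOver τ A) (hB : DefinableOver τ B) :
    DefinableOver (V := V) τ fun M _ _ v => A M v → B M v := by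
  obtain ⟨φ, hφ, h⟩ := hA
  obtain ⟨ψ, hψ, h'⟩ := hB
  exact ⟨φ.imp ψ, Set.union_subset hφ hψ, fun M _ _ v => imp_congr (h M v) (h' M v)⟩

theorem not (hA : DefinableOver τ A) : DefinableOver (V := V) τ fun M _ _ v => ¬ A M v := hA.imp false

theorem true : DefinableOver (V := V) τ (n := n) fun _ _ _ _ => True :=
  (false.imp false).congr fun _ _ _ _ => by simp

theorem and (hA : DefinableOver τ A) (hB : DefinableOver τ B) :
    DefinableOver (V := V) τ fun M _ _ v => A M v ∧ B M v :=
  (hA.imp hB.not).not.congr fun _ _ _ _ => by tauto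

theorem or (hA : DefinableOver τ A) (hB : DefinableOver τ B) :
    DefinableOver (V := V) τ fun M _ _ v => A M v ∨ B M v :=
  (hA.not.imp hB).congr fun _ _ _ _ => by tauto

theorem iff (hA : DefinableOver τ A) (hB : DefinableOver τ B) :
    DefinableOver (V := V) τ fun M _ _ v => A M v ↔ B M v :=
  ((hA.imp hB).and (hB.imp hA)).congr fun _ _ _ _ => by tauto

theorem all {A : ∀ (M : Type) [Finite M] [(voc V).Structure M], (Fin n → M) → M → Prop}
    (hA : DefinableOver (V := V) τ (n := n + 1) fun M _ _ w => A M (fun i => w i.castSucc) (w (.last n))) :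
    DefinableOver (V := V) τ fun M _ _ v => ∀ x, A M v x := by
  obtain ⟨φ, hφ, h⟩ := hA
  refine ⟨φ.all, hφ, fun M _ _ v => forall_congr' fun x => ?_⟩
  rw [h]
  simp only [Fin.snoc_castSucc, Fin.snoc_last]

theorem ex {A : ∀ (M : Type) [Finite M] [(voc V).Structure M], (Fin n → M) → M → Prop}
    (hA : DefinableOver (V := V) τ (n := n + 1) fun M _ _ w => A M (fun i => w i.castSucc) (w (.last n))) :
    DefinableOver (V := V) τ fun M _ _ v => ∃ x, A M v x :=
  (all (A := fun M _ _ v x => ¬ A M v x) hA.not).not.congr fun _ _ _ _ => by simp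

theorem forall_tuple {A : ∀ (M : Type) [Finite M] [(voc V).Structure M], (Fin n → M) → Prop}
    (hA : DefinableOver τ A) :
    DefinableOver (V := V) τ (n := 0) fun M _ _ _ => ∀ v, A M v := by
  induction n with
  | zero => exact hA.congr fun M _ _ v => ⟨fun h v' => Subsingleton.elim v v' ▸ h, fun h => h v⟩
  | succ n ih =>
    refine (ih (A := fun M _ _ v => ∀ x, A M (Fin.snoc v x)) (all ?_)).congr fun M _ _ v => ?_
    · refine hA.congr fun M _ _ v => ?_
      rw [show (Fin.snoc (fun i => v i.castSucc) (v (.last n)) : Fin (n + 1) → M) = v from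
        Fin.snoc_init_self v]
    · refine ⟨fun h v => ?_, fun h v x => h _⟩
      have := h (Fin.init v) (v (.last n))
      rwa [Fin.snoc_init_self] at this

theorem forall_finite {ι : Type} [Finite ι]
    {A : ι → ∀ (M : Type) [Finite M] [(voc V).Structure M], (Fin n → M) → Prop}
    (hA : ∀ i, DefinableOver τ (A i)) : DefinableOver (V := V) τ fun M _ _ v => ∀ i, A i M v := by
  classical
  have := Fintype.ofFinite ι
  have key : ∀ s : Finset ι, DefinableOver (V := V) τ fun M _ _ v => ∀ i ∈ s, A i M v := fun s => by
    induction s using Finset.induction_on with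
    | empty => exact true.congr fun _ _ _ _ => by simp
    | insert i s _ ih => exact ((hA i).and ih).congr fun _ _ _ _ => by simp
  exact (key Finset.univ).congr fun _ _ _ _ => by simp

theorem eq (i j : Fin n) : DefinableOver (V := V) τ fun _ _ _ v => v i = v j :=
  ⟨.equal (.var (.inr i)) (.var (.inr j)), Set.empty_subset _, fun _ _ _ _ => Iff.rfl⟩

theorem rel {k i : ℕ} (hi : (k, i) ∈ V) (hτ : (k, i) ∈ τ) (f : Fin k → Fin n) :
    DefinableOver (V := V) τ fun _ _ _ v =>
      Language.Structure.RelMap (relSym hi) fun j => v (f j) :=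
  ⟨.rel (relSym hi) fun j => .var (.inr (f j)), Set.singleton_subset_iff.2 hτ,
    fun _ _ _ _ => Iff.rfl⟩

theorem exists_sentence {A : ∀ (M : Type) [Finite M] [(voc V).Structure M], Prop}
    (h : DefinableOver (V := V) τ (n := 0) fun M _ _ _ => A M) :
    ∃ φ : (voc V).Sentence, symbols φ ⊆ τ ∧
      ∀ (M : Type) [Finite M] [(voc V).Structure M], M ⊨ φ ↔ A M := by
  obtain ⟨φ, hφ, h⟩ := h
  exact ⟨φ, hφ, fun M _ _ => h M default⟩

end DefinableOver

/-! ### Counting the diagonal of a relation symbol -/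

/-- The unary predicate given by the diagonal of a relation symbol. -/
def diagonal {k i : ℕ} (hi : (k, i) ∈ V) {M : Type} [(voc V).Structure M] (x : M) : Prop :=
  Language.Structure.RelMap (relSym hi) fun _ => x

/-- The relation symbol depends on its first argument only. -/
def FirstArgOnly {k i : ℕ} (hi : (k, i) ∈ V) (hk : 0 < k) (M : Type) [(voc V).Structure M] :
    Prop :=
  ∀ xs : Fin k → M, Language.Structure.RelMap (relSym hi) xs ↔ diagonal hi (xs ⟨0, hk⟩)

section Diagonal

variable {k i : ℕ} (hi : (k, i) ∈ V) {τ : Set (ℕ × ℕ)} (hτ : (k, i) ∈ τ)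

include hτ in
theorem definableOver_diagonal {n : ℕ} (j : Fin n) :
    DefinableOver (V := V) τ fun _ _ _ v => diagonal hi (v j) :=
  DefinableOver.rel hi hτ fun _ => j

include hτ in
theorem definableOver_firstArgOnly (hk : 0 < k) :
    DefinableOver (V := V) τ (n := 0) fun M _ _ _ => FirstArgOnly hi hk M :=
  ((DefinableOver.rel hi hτ id).iff (definableOver_diagonal hi hτ _)).forall_tuple

/-- Counting becomes first-order by choosing one element at a time, with the tuple `v` remembering
those already chosen. -/
theorem ncard_diff_range_le_iff {M : Type} [Finite M] (P : M → Prop) {m : ℕ} (v : Fin m → M)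
    (n : ℕ) : n + 1 ≤ {x | P x ∧ ∀ j, x ≠ v j}.ncard ↔
      ∃ x, P x ∧ (∀ j, x ≠ v j) ∧
        n ≤ {y | P y ∧ ∀ j, y ≠ (Fin.snoc v x : Fin (m + 1) → M) j}.ncard := by
  have key : ∀ x, {y | P y ∧ ∀ j, y ≠ (Fin.snoc v x : Fin (m + 1) → M) j} =
      {y | P y ∧ ∀ j, y ≠ v j} \ {x} := fun x => by
    ext y
    simp only [Fin.forall_fin_succ', Fin.snoc_castSucc, Fin.snoc_last, Set.mem_sdiff,
      Set.mem_singleton_iff, Set.mem_ofPred_eq]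
    tauto
  simp only [key]
  constructor
  · intro h
    obtain ⟨x, hx⟩ := (Set.ncard_pos (s := {x | P x ∧ ∀ j, x ≠ v j}) (Set.toFinite _)).1 (by omega)
    refine ⟨x, hx.1, hx.2, ?_⟩
    rw [Set.ncard_sdiff_singleton_of_mem hx]
    omega
  · rintro ⟨x, h1, h2, h3⟩
    have hx : x ∈ {x | P x ∧ ∀ j, x ≠ v j} := ⟨h1, h2⟩
    have := Set.ncard_sdiff_singleton_add_one hx (Set.toFinite _)
    omega

include hτ in
theorem definableOver_le_ncard (n m : ℕ) : DefinableOver (V := V) τ (n := m) fun M _ _ v =>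
    n ≤ {x : M | diagonal hi x ∧ ∀ j, x ≠ v j}.ncard := by
  induction n generalizing m with
  | zero => exact DefinableOver.true.congr fun _ _ _ _ => by simp
  | succ n ih =>
    refine DefinableOver.congr (A := fun M _ _ v => ∃ x : M, diagonal hi x ∧ (∀ j, x ≠ v j) ∧
      n ≤ {y | diagonal hi y ∧ ∀ j, y ≠ (Fin.snoc v x : Fin (m + 1) → M) j}.ncard) ?_
      fun M _ _ v => (ncard_diff_range_le_iff _ v n).symm
    refine .ex (.and (definableOver_diagonal hi hτ _) (.and ?_ ?_))
    · exact .forall_finite fun j => .not (.eq _ _)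
    · refine (ih (m + 1)).congr fun M _ _ v => ?_
      rw [show (Fin.snoc (fun i => v i.castSucc) (v (.last m)) : Fin (m + 1) → M) = v from
        Fin.snoc_init_self v]

include hτ in
theorem definableOver_ncard_eq (n : ℕ) : DefinableOver (V := V) τ (n := 0) fun M _ _ _ =>
    {x : M | diagonal hi x}.ncard = n :=
  ((definableOver_le_ncard hi hτ n 0).and (definableOver_le_ncard hi hτ (n + 1) 0).not).congr
    fun _ _ _ _ => by simp only [IsEmpty.forall_iff, and_true]; omega

end Diagonal

/-! ### Computations as relations on finite linear orders -/

open Nat.Partrec (Code)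

section Computation

variable {M : Type}

/-- `x` is the least element of the order `lt`. -/
def IsZero (lt : M → M → Prop) (x : M) : Prop := ¬ ∃ y, lt y x

/-- `y` is the successor of `x` in the order `lt`. -/
def IsSucc (lt : M → M → Prop) (x y : M) : Prop := lt x y ∧ ¬ ∃ z, lt x z ∧ lt z y

/-- The pair `(a', b')` follows the pair `(a, b)` in the enumeration of pairs by `Nat.unpair`. -/
def IsNextPair (lt : M → M → Prop) (a b a' b' : M) : Prop :=
  (lt a b ∧ IsSucc lt a a' ∧ lt a' b ∧ b' = b) ∨
  (IsSucc lt a b ∧ a' = b ∧ IsZero lt b') ∨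
  (lt b a ∧ a' = a ∧ IsSucc lt b b') ∨
  (a = b ∧ IsZero lt a' ∧ IsSucc lt a b')

/-- What justifies that the program `c` has the value `y` at `x`, if `ev` holds of other values. -/
def EvalRule (lt fst snd : M → M → Prop) (ev : Code → M → M → Prop) : Code → M → M → Prop
  | .zero, _, y => IsZero lt y
  | .succ, x, y => IsSucc lt x y
  | .left, x, y => fst x y
  | .right, x, y => snd x y
  | .pair f g, x, y => ∃ y₁ y₂, ev f x y₁ ∧ ev g x y₂ ∧ fst y y₁ ∧ snd y y₂
  | .comp f g, x, y => ∃ z, ev g x z ∧ ev f z y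
  | .prec f g, x, y => ∃ a k, fst x a ∧ snd x k ∧
      ((IsZero lt k ∧ ev f a y) ∨
        ∃ k' z w₁ w₂ w, IsSucc lt k' k ∧ fst w₁ a ∧ snd w₁ k' ∧ ev (.prec f g) w₁ z ∧
          fst w₂ k' ∧ snd w₂ z ∧ fst w a ∧ snd w w₂ ∧ ev g w y)
  | .rfind' f, x, y => ∃ a k z, fst x a ∧ snd x k ∧ ev f x z ∧
      ((IsZero lt z ∧ y = k) ∨
        (¬ IsZero lt z ∧ ∃ k' w, IsSucc lt k k' ∧ fst w a ∧ snd w k' ∧ ev (.rfind' f) w y))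

/-- A rule consults only subprograms and the program itself, none with a larger number. Recording
the programs up to the number of `u` is therefore enough. -/
theorem EvalRule.mono {lt fst snd : M → M → Prop} {ev ev' : Code → M → M → Prop} {c : Code}
    {x y : M} (h : EvalRule lt fst snd ev c x y)
    (hev : ∀ d, Encodable.encode d ≤ Encodable.encode c → ∀ x y, ev d x y → ev' d x y) :
    EvalRule lt fst snd ev' c x y := by
  cases c with
  | zero | succ | left | right => exact h
  | pair f g =>
    obtain ⟨hf, hg⟩ := Code.encode_lt_pair f g
    obtain ⟨y₁, y₂, h1, h2, h3⟩ := h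
    exact ⟨y₁, y₂, hev f hf.le _ _ h1, hev g hg.le _ _ h2, h3⟩
  | comp f g =>
    obtain ⟨hf, hg⟩ := Code.encode_lt_comp f g
    obtain ⟨z, h1, h2⟩ := h
    exact ⟨z, hev g hg.le _ _ h1, hev f hf.le _ _ h2⟩
  | prec f g =>
    obtain ⟨hf, hg⟩ := Code.encode_lt_prec f g
    obtain ⟨a, k, ha, hk, ⟨h0, h1⟩ | ⟨k', z, w₁, w₂, w, h1, h2, h3, h4, h5, h6, h7, h8, h9⟩⟩ := h
    · exact ⟨a, k, ha, hk, .inl ⟨h0, hev f hf.le _ _ h1⟩⟩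
    · exact ⟨a, k, ha, hk, .inr ⟨k', z, w₁, w₂, w, h1, h2, h3, hev _ le_rfl _ _ h4, h5, h6, h7, h8,
        hev g hg.le _ _ h9⟩⟩
  | rfind' f =>
    obtain ⟨a, k, z, ha, hk, hz, h0 | ⟨h0, k', w, h1, h2, h3, h4⟩⟩ := h
    · exact ⟨a, k, z, ha, hk, hev f (Code.encode_lt_rfind' f).le _ _ hz, .inl h0⟩
    · exact ⟨a, k, z, ha, hk, hev f (Code.encode_lt_rfind' f).le _ _ hz,
        .inr ⟨h0, k', w, h1, h2, h3, hev _ le_rfl _ _ h4⟩⟩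

/-- The programs with a number of at most that of `u`. -/
abbrev CodeLE (u : Code) : Type := {c : Code // Encodable.encode c ≤ Encodable.encode u}

instance (u : Code) : Finite (CodeLE u) :=
  Finite.of_injective
    (fun c => (⟨Encodable.encode c.1, Nat.lt_succ_of_le c.2⟩ : Fin (Encodable.encode u + 1)))
    fun _ _ h => Subtype.ext (Encodable.encode_injective (Fin.mk.inj h))

/-- A halting computation of the program `u`, recorded on an initial segment of the natural numbers
with order `lt` and unpairing functions `fst` and `snd`. The input is the least element outside
the initial segment `P`. -/
structure IsComputation (u : Code) (P : M → Prop) (lt fst snd : M → M → Prop)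
    (ev : Code → M → M → Prop) : Prop where
  irrefl : ∀ x, ¬ lt x x
  trans : ∀ x y z, lt x y → lt y z → lt x z
  total : ∀ x y, lt x y ∨ x = y ∨ lt y x
  unpair_total : ∀ z, ∃ a b, fst z a ∧ snd z b
  unpair_zero : ∀ z a b, IsZero lt z → fst z a → snd z b → IsZero lt a ∧ IsZero lt b
  unpair_succ : ∀ z z' a b a' b', IsSucc lt z z' → fst z a → snd z b → fst z' a' → snd z' b' →
    IsNextPair lt a b a' b'
  rule : ∀ c : CodeLE u, ∀ x y, ev c x y → EvalRule lt fst snd ev c x y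
  initial : ∀ x y, lt x y → P y → P x
  halts : ∃ x y, ¬ P x ∧ (∀ w, lt w x → P w) ∧ ev u x y

/-! ### Soundness: recorded computations really halt -/

theorem pair_succ_of_lt {a b : ℕ} (h : a + 1 < b) : Nat.pair (a + 1) b = Nat.pair a b + 1 := by
  rw [Nat.pair, Nat.pair, if_pos h, if_pos (by omega)]
  omega

theorem pair_succ_zero (a : ℕ) : Nat.pair (a + 1) 0 = Nat.pair a (a + 1) + 1 := by
  rw [Nat.pair, Nat.pair, if_neg (by omega), if_pos (by omega)]
  omega

theorem pair_succ_right {a b : ℕ} (h : b < a) : Nat.pair a (b + 1) = Nat.pair a b + 1 := by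
  rw [Nat.pair, Nat.pair, if_neg (by omega), if_neg (by omega)]
  omega

theorem pair_zero_succ (a : ℕ) : Nat.pair 0 (a + 1) = Nat.pair a a + 1 := by
  rw [Nat.pair, Nat.pair, if_pos (by omega), if_neg (by omega)]
  ring

theorem mem_eval_prec_zero {f g : Code} {a y : ℕ} (h : y ∈ f.eval a) :
    y ∈ (Code.prec f g).eval (Nat.pair a 0) := by
  rwa [Code.eval_prec_zero]

theorem mem_eval_prec_succ {f g : Code} {a k z y : ℕ} (hz : z ∈ (Code.prec f g).eval (Nat.pair a k))
    (h : y ∈ g.eval (Nat.pair a (Nat.pair k z))) :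
    y ∈ (Code.prec f g).eval (Nat.pair a (k + 1)) := by
  rw [Code.eval_prec_succ]
  exact Part.mem_bind hz h

theorem mem_eval_rfind' {f : Code} {a k y : ℕ} :
    y ∈ (Code.rfind' f).eval (Nat.pair a k) ↔ ∃ n, (0 ∈ f.eval (Nat.pair a (n + k)) ∧
      ∀ m < n, ∃ z ∈ f.eval (Nat.pair a (m + k)), z ≠ 0) ∧ n + k = y := by
  simp only [Code.eval, Nat.unpaired, Nat.unpair_pair, Part.map_eq_map, Part.mem_map_iff]
  refine exists_congr fun n => and_congr (Nat.mem_rfind.trans ?_) Iff.rfl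
  simp

theorem mem_eval_rfind'_zero {f : Code} {a k : ℕ} (h : 0 ∈ f.eval (Nat.pair a k)) :
    k ∈ (Code.rfind' f).eval (Nat.pair a k) :=
  mem_eval_rfind'.2 ⟨0, ⟨by simpa using h, by simp⟩, by simp⟩

theorem mem_eval_rfind'_succ {f : Code} {a k z y : ℕ} (hz : z ∈ f.eval (Nat.pair a k))
    (hz0 : z ≠ 0) (h : y ∈ (Code.rfind' f).eval (Nat.pair a (k + 1))) :
    y ∈ (Code.rfind' f).eval (Nat.pair a k) := by
  obtain ⟨n, ⟨hn, hlt⟩, rfl⟩ := mem_eval_rfind'.1 h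
  refine mem_eval_rfind'.2 ⟨n + 1, ⟨?_, ?_⟩, by omega⟩
  · rwa [show n + 1 + k = n + (k + 1) by omega]
  · intro m hm
    rcases m with _ | m
    · exact ⟨z, by simpa using hz, hz0⟩
    · rw [show m + 1 + k = m + (k + 1) by omega]
      exact hlt m (by omega)

/-- The number of elements below `x`. -/
noncomputable def rank (lt : M → M → Prop) (x : M) : ℕ := {y | lt y x}.ncard

namespace IsComputation

variable {u : Code} {P : M → Prop} {lt fst snd : M → M → Prop} {ev : Code → M → M → Prop}

theorem rank_eq_zero {x : M} (hx : IsZero lt x) : rank lt x = 0 := by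
  have : {y | lt y x} = ∅ := Set.eq_empty_of_forall_notMem fun y hy => hx ⟨y, hy⟩
  rw [rank, this, Set.ncard_empty]

variable [Finite M]

theorem rank_ne_zero {x : M} (hx : ¬ IsZero lt x) : rank lt x ≠ 0 := by
  obtain ⟨y, hy⟩ := not_not.1 hx
  exact ((Set.ncard_pos (Set.toFinite _)).2 ⟨y, hy⟩).ne'

variable (h : IsComputation u P lt fst snd ev)

include h

theorem rank_lt {x y : M} (hxy : lt x y) : rank lt x < rank lt y :=
  Set.ncard_lt_ncard ⟨fun z hz => h.trans z x y hz hxy, fun hs => h.irrefl x (hs hxy)⟩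

theorem rank_succ {x y : M} (hxy : IsSucc lt x y) : rank lt y = rank lt x + 1 := by
  have : {z | lt z y} = insert x {z | lt z x} := by
    ext z
    constructor
    · intro hz
      rcases h.total z x with h' | h' | h'
      · exact .inr h'
      · exact .inl h'
      · exact (hxy.2 ⟨z, h', hz⟩).elim
    · rintro (rfl | hz)
      · exact hxy.1
      · exact h.trans _ _ _ hz hxy.1
  rw [rank, this, Set.ncard_insert_of_notMem (s := {z | lt z x}) (h.irrefl x) (Set.toFinite _), rank]

theorem exists_pred {z : M} (hz : ¬ IsZero lt z) : ∃ w, IsSucc lt w z := by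
  obtain ⟨w, hw, hmax⟩ := Set.exists_max_image {w | lt w z} (rank lt) (Set.toFinite _)
    (not_not.1 hz)
  exact ⟨w, hw, fun ⟨v, hwv, hvz⟩ => (h.rank_lt hwv).not_ge (hmax v hvz)⟩

/-- `Nat.pair` enumerates pairs along square shells, and `IsNextPair` lists the four possible steps.
Induction along the order therefore identifies the recorded unpairing with the true one, as far as
the finite order reaches. -/
theorem rank_eq_pair {z a b : M} (ha : fst z a) (hb : snd z b) :
    rank lt z = Nat.pair (rank lt a) (rank lt b) := by
  induction hr : rank lt z generalizing z a b with
  | zero =>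
    have hz : IsZero lt z := by_contra fun hz => rank_ne_zero hz hr
    obtain ⟨ha0, hb0⟩ := h.unpair_zero z a b hz ha hb
    rw [rank_eq_zero ha0, rank_eq_zero hb0]
    rfl
  | succ n ih =>
    have hz : ¬ IsZero lt z := fun hz => by rw [rank_eq_zero hz] at hr; omega
    obtain ⟨w, hw⟩ := h.exists_pred hz
    have hwz := h.rank_succ hw
    have hwn : rank lt w = n := by omega
    obtain ⟨a₀, b₀, ha₀, hb₀⟩ := h.unpair_total w
    have hpair := ih ha₀ hb₀ hwn
    rcases h.unpair_succ w z a₀ b₀ a b hw ha₀ hb₀ ha hb with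
      ⟨-, h2, h3, rfl⟩ | ⟨h1, rfl, h3⟩ | ⟨h1, rfl, h3⟩ | ⟨rfl, h2, h3⟩
    · have := h.rank_lt h3
      rw [h.rank_succ h2] at this ⊢
      rw [pair_succ_of_lt this, ← hpair]
    · rw [h.rank_succ h1] at hpair ⊢
      rw [rank_eq_zero h3, pair_succ_zero, ← hpair]
    · rw [h.rank_succ h3, pair_succ_right (h.rank_lt h1), ← hpair]
    · rw [h.rank_succ h3, rank_eq_zero h2, pair_zero_succ, ← hpair]

/-- Justification by other recorded values proves a value correct because the chain of
justifications is well-founded: it passes to subprograms, lowers the counter of `prec`, or raises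
the counter of `rfind'`, which the finite order bounds. -/
theorem mem_eval (c : Code) (hc : Encodable.encode c ≤ Encodable.encode u) {x y : M}
    (hxy : ev c x y) : rank lt y ∈ c.eval (rank lt x) := by
  induction c generalizing x y with
  | zero =>
    have hr : IsZero lt y := h.rule ⟨_, hc⟩ x y hxy
    rw [rank_eq_zero hr]
    exact Part.mem_some _
  | succ =>
    have hr : IsSucc lt x y := h.rule ⟨_, hc⟩ x y hxy
    rw [h.rank_succ hr]
    exact Part.mem_some _
  | left =>
    have hr : fst x y := h.rule ⟨_, hc⟩ x y hxy
    obtain ⟨_, b, -, hb⟩ := h.unpair_total x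
    rw [h.rank_eq_pair hr hb]
    simp [Code.eval]
  | right =>
    have hr : snd x y := h.rule ⟨_, hc⟩ x y hxy
    obtain ⟨a, _, ha, -⟩ := h.unpair_total x
    rw [h.rank_eq_pair ha hr]
    simp [Code.eval]
  | pair f g ihf ihg =>
    obtain ⟨hf, hg⟩ := Code.encode_lt_pair f g
    obtain ⟨y₁, y₂, h1, h2, h3, h4⟩ := h.rule ⟨_, hc⟩ x y hxy
    rw [h.rank_eq_pair h3 h4]
    have h5 := ihf (by omega) h1
    have h6 := ihg (by omega) h2
    simpa [Code.eval, Seq.seq] using ⟨h5, h6⟩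
  | comp f g ihf ihg =>
    obtain ⟨hf, hg⟩ := Code.encode_lt_comp f g
    obtain ⟨z, h1, h2⟩ := h.rule ⟨_, hc⟩ x y hxy
    exact Part.mem_bind (ihg (by omega) h1) (ihf (by omega) h2)
  | prec f g ihf ihg =>
    obtain ⟨hf, hg⟩ := Code.encode_lt_prec f g
    have key : ∀ (n : ℕ) (x y a k : M), fst x a → snd x k → rank lt k = n →
        ev (.prec f g) x y → rank lt y ∈ (Code.prec f g).eval (Nat.pair (rank lt a) n) := by
      intro n
      induction n with
      | zero =>
        intro x y a k ha hk hn hxy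
        obtain ⟨a', k', ha', hk', hr⟩ := h.rule ⟨_, hc⟩ x y hxy
        -- The components named by the rule need not be given as the same elements `a` and `k`;
        -- injectivity of `Nat.pair` shows that their ranks agree.
        have h1 := (h.rank_eq_pair ha hk).symm.trans (h.rank_eq_pair ha' hk')
        obtain ⟨h2, h3⟩ := Nat.pair_eq_pair.1 h1
        rcases hr with ⟨-, hr⟩ | ⟨k'', _, _, _, _, hk'', -⟩
        · rw [h2]
          exact mem_eval_prec_zero (ihf (by omega) hr)
        · have := h.rank_succ hk''
          omega
      | succ n ih =>
        intro x y a k ha hk hn hxy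
        obtain ⟨a', k', ha', hk', hr⟩ := h.rule ⟨_, hc⟩ x y hxy
        have h1 := (h.rank_eq_pair ha hk).symm.trans (h.rank_eq_pair ha' hk')
        obtain ⟨h2, h3⟩ := Nat.pair_eq_pair.1 h1
        rcases hr with ⟨h0, -⟩ | ⟨k'', z, w₁, w₂, w, h4, h5, h6, h7, h8, h9, h10, h11, h12⟩
        · have := rank_eq_zero h0
          omega
        · have h13 := h.rank_succ h4
          have hkn : rank lt k'' = n := by omega
          have h14 := ihg (by omega) h12
          rw [h.rank_eq_pair h10 h11, h.rank_eq_pair h8 h9, hkn] at h14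
          rw [h2]
          exact mem_eval_prec_succ (ih w₁ z a' k'' h5 h6 hkn h7) h14
    obtain ⟨a, k, ha, hk⟩ := h.unpair_total x
    rw [h.rank_eq_pair ha hk]
    exact key _ x y a k ha hk rfl hxy
  | rfind' f ihf =>
    have hf := Code.encode_lt_rfind' f
    -- `d` bounds the room left above the counter `k`; at `d = 0` the rank of `k` would have to
    -- reach the size of `M`.
    have key : ∀ (d : ℕ) (x y a k : M), fst x a → snd x k → Nat.card M ≤ rank lt k + d →
        ev (.rfind' f) x y →
        rank lt y ∈ (Code.rfind' f).eval (Nat.pair (rank lt a) (rank lt k)) := by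
      intro d
      induction d with
      | zero =>
        intro x y a k ha hk hd hxy
        have h1 : rank lt k < Nat.card M :=
          Set.ncard_lt_card fun hu => h.irrefl k (hu ▸ Set.mem_univ k : k ∈ {y | lt y k})
        omega
      | succ d ih =>
        intro x y a k ha hk hd hxy
        obtain ⟨a', k', z, ha', hk', hz, hr⟩ := h.rule ⟨_, hc⟩ x y hxy
        have h1 := (h.rank_eq_pair ha hk).symm.trans (h.rank_eq_pair ha' hk')
        obtain ⟨h2, h3⟩ := Nat.pair_eq_pair.1 h1
        have h4 := ihf (by omega) hz
        rw [h.rank_eq_pair ha' hk'] at h4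
        rw [h2, h3]
        rcases hr with ⟨h0, rfl⟩ | ⟨h0, k'', w, h5, h6, h7, h8⟩
        · rw [rank_eq_zero h0] at h4
          exact mem_eval_rfind'_zero h4
        · have h9 := h.rank_succ h5
          have h10 := ih w y a' k'' h6 h7 (by omega) h8
          rw [h9] at h10
          exact mem_eval_rfind'_succ h4 (rank_ne_zero h0) h10
    obtain ⟨a, k, ha, hk⟩ := h.unpair_total x
    rw [h.rank_eq_pair ha hk]
    exact key (Nat.card M) x y a k ha hk (by omega) hxy

/-- `P` consists exactly of the elements below the input `x`, so its size is the rank of `x`. -/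
theorem eval_dom : (u.eval {x | P x}.ncard).Dom := by
  obtain ⟨x, y, hx, hlow, hxy⟩ := h.halts
  have : {w | P w} = {w | lt w x} := by
    ext w
    refine ⟨fun hw => ?_, hlow w⟩
    rcases h.total w x with h' | rfl | h'
    · exact h'
    · exact (hx hw).elim
    · exact (hx (h.initial x w h' hw)).elim
  rw [this]
  exact Part.dom_iff_mem.2 ⟨_, h.mem_eval u le_rfl hxy⟩

end IsComputation

/-! ### Completeness: halting computations can be recorded -/

theorem isZero_fin {m : ℕ} {x : Fin m} : IsZero (· < ·) x ↔ (x : ℕ) = 0 := by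
  constructor
  · intro h
    by_contra hx
    exact h ⟨⟨0, by omega⟩, Fin.lt_def.2 (by simp; omega)⟩
  · rintro h ⟨y, hy⟩
    rw [Fin.lt_def] at hy
    omega

theorem isSucc_fin {m : ℕ} {x y : Fin m} : IsSucc (· < ·) x y ↔ (y : ℕ) = x + 1 := by
  simp only [IsSucc, Fin.lt_def]
  constructor
  · rintro ⟨h1, h2⟩
    by_contra hne
    exact h2 ⟨⟨x + 1, by omega⟩, by simp, by simp; omega⟩
  · intro h
    exact ⟨by omega, fun ⟨z, h1, h2⟩ => by omega⟩

theorem isNextPair_fin {m : ℕ} {a b a' b' : Fin m}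
    (h : Nat.pair a' b' = Nat.pair a b + 1) : IsNextPair (· < ·) a b a' b' := by
  simp only [IsNextPair, isSucc_fin, isZero_fin]
  simp only [Fin.lt_def, Fin.ext_iff]
  rcases lt_trichotomy (a : ℕ) b with hab | hab | hab
  · rcases Nat.lt_or_ge ((a : ℕ) + 1) b with h1 | h1
    · rw [← pair_succ_of_lt h1, Nat.pair_eq_pair] at h
      omega
    · rw [show (b : ℕ) = a + 1 by omega, ← pair_succ_zero, Nat.pair_eq_pair] at h
      omega
  · rw [← hab, ← pair_zero_succ, Nat.pair_eq_pair] at h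
    omega
  · rw [← pair_succ_right hab, Nat.pair_eq_pair] at h
    omega

/-- Fuel `K` bounds the inputs but not the outputs. Finitely many programs and inputs give finitely
many outputs, so a larger universe holds them all. -/
theorem exists_output_bound (u : Code) (K : ℕ) : ∃ m, K ≤ m ∧ ∀ c : CodeLE u, ∀ x y,
    y ∈ Code.evaln K c.1 x → y < m := by
  have hfin : (⋃ c : CodeLE u, ⋃ x : Fin K, {y | y ∈ Code.evaln K c.1 x}).Finite := by
    refine Set.finite_iUnion fun c => Set.finite_iUnion fun x => Set.Subsingleton.finite ?_
    intro y hy z hz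
    exact Option.mem_unique hy hz
  obtain ⟨m, hm⟩ := hfin.bddAbove
  refine ⟨max K (m + 1), le_max_left _ _, fun c x y hy => ?_⟩
  have := hm (Set.mem_iUnion.2 ⟨c, Set.mem_iUnion.2 ⟨⟨x, Code.evaln_bound hy⟩, hy⟩⟩)
  exact lt_max_of_lt_right (Nat.lt_succ_of_le this)

theorem evalRule_fin {u : Code} {K m : ℕ} (hKm : K ≤ m)
    (hm : ∀ c : CodeLE u, ∀ x y, y ∈ Code.evaln K c.1 x → y < m) (c : CodeLE u) (x y : Fin m)
    (hxy : (y : ℕ) ∈ Code.evaln K c.1 x) :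
    EvalRule (· < ·) (fun z a : Fin m => (Nat.unpair z).1 = a)
      (fun z b => (Nat.unpair z).2 = b) (fun c x y => (y : ℕ) ∈ Code.evaln K c x) c.1 x y := by
  obtain ⟨c, hc⟩ := c
  have hx := Code.evaln_bound hxy
  obtain ⟨k, rfl⟩ : ∃ k, K = k + 1 := ⟨K - 1, by omega⟩
  -- Self-calls of `prec` and `rfind'` run with one unit less fuel; monotonicity brings them back
  -- into the recorded relation at fuel `K`.
  have lift : ∀ {z : ℕ} {c : Code} {x : ℕ}, z ∈ Code.evaln k c x → z ∈ Code.evaln (k + 1) c x :=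
    fun h => Code.evaln_mono (Nat.le_succ k) h
  cases c with
  | zero =>
    simp [Code.evaln, Option.bind_eq_some_iff] at hxy
    exact isZero_fin.2 hxy.2.symm
  | succ =>
    simp [Code.evaln, Option.bind_eq_some_iff] at hxy
    exact isSucc_fin.2 hxy.2.symm
  | left =>
    simp [Code.evaln, Option.bind_eq_some_iff] at hxy
    exact hxy.2
  | right =>
    simp [Code.evaln, Option.bind_eq_some_iff] at hxy
    exact hxy.2
  | pair f g =>
    simp [Code.evaln, Option.bind_eq_some_iff, Seq.seq] at hxy
    obtain ⟨-, y₁, h1, y₂, h2, h3⟩ := hxy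
    have h4 := Nat.left_le_pair y₁ y₂
    have h5 := Nat.right_le_pair y₁ y₂
    refine ⟨⟨y₁, by omega⟩, ⟨y₂, by omega⟩, h1, h2, ?_, ?_⟩ <;> simp [← h3]
  | comp f g =>
    simp [Code.evaln, Option.bind_eq_some_iff] at hxy
    obtain ⟨-, z, h1, h2⟩ := hxy
    have h3 := Code.evaln_bound h2
    exact ⟨⟨z, by omega⟩, h1, h2⟩
  | prec f g =>
    have h0 := Nat.pair_unpair x
    have h1 := Nat.unpair_left_le x
    have h2 := Nat.unpair_right_le x
    simp [Code.evaln, Option.bind_eq_some_iff] at hxy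
    obtain ⟨-, hxy⟩ := hxy
    refine ⟨⟨(Nat.unpair x).1, by omega⟩, ⟨(Nat.unpair x).2, by omega⟩, rfl, rfl, ?_⟩
    obtain hk | ⟨n, hk⟩ : (Nat.unpair x).2 = 0 ∨ ∃ n, (Nat.unpair x).2 = n + 1 := by
      cases (Nat.unpair x).2 <;> simp
    · rw [hk] at hxy
      exact .inl ⟨isZero_fin.2 hk, hxy⟩
    · rw [hk] at hxy
      simp [Option.bind_eq_some_iff] at hxy
      obtain ⟨z, h3, h4⟩ := hxy
      have h5 := Code.evaln_bound h3
      have h6 := Code.evaln_bound h4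
      have h7 := Nat.right_le_pair (Nat.unpair x).1 (Nat.pair n z)
      have h8 := Nat.right_le_pair n z
      refine .inr ⟨⟨n, by omega⟩, ⟨z, by omega⟩, ⟨Nat.pair (Nat.unpair x).1 n, by omega⟩,
        ⟨Nat.pair n z, by omega⟩, ⟨Nat.pair (Nat.unpair x).1 (Nat.pair n z), by omega⟩,
        isSucc_fin.2 hk, ?_, ?_, lift h3, ?_, ?_, ?_, ?_, h4⟩ <;> simp
  | rfind' f =>
    have h1 := Nat.unpair_left_le x
    have h2 := Nat.unpair_right_le x
    have hf := Code.encode_lt_rfind' f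
    simp [Code.evaln, Option.bind_eq_some_iff] at hxy
    obtain ⟨-, z, hz, hxy⟩ := hxy
    -- The tested value `z` is neither an input of another call nor a part of `y`, so only the
    -- output bound places it in the universe.
    have h3 := hm ⟨f, by omega⟩ _ _ hz
    refine ⟨⟨(Nat.unpair x).1, by omega⟩, ⟨(Nat.unpair x).2, by omega⟩, ⟨z, h3⟩, rfl, rfl, hz, ?_⟩
    by_cases hz0 : z = 0
    · simp [hz0] at hxy
      exact .inl ⟨isZero_fin.2 hz0, Fin.ext hxy.symm⟩
    · simp [hz0] at hxy
      have h4 := Code.evaln_bound hxy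
      have h5 := Nat.right_le_pair (Nat.unpair x).1 ((Nat.unpair x).2 + 1)
      refine .inr ⟨fun h => hz0 (isZero_fin.1 h), ⟨(Nat.unpair x).2 + 1, by omega⟩,
        ⟨Nat.pair (Nat.unpair x).1 ((Nat.unpair x).2 + 1), by omega⟩, isSucc_fin.2 rfl, ?_, ?_,
        lift hxy⟩ <;> simp

theorem exists_isComputation {u : Code} {n : ℕ} (h : (u.eval n).Dom) :
    ∃ (m : ℕ) (fst snd : Fin m → Fin m → Prop) (ev : Code → Fin m → Fin m → Prop), n < m ∧
      IsComputation u (fun x : Fin m => (x : ℕ) < n) (· < ·) fst snd ev := by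
  obtain ⟨y, hy⟩ := Part.dom_iff_mem.1 h
  obtain ⟨K, hK⟩ := Code.evaln_complete.1 hy
  obtain ⟨m, hKm, hm⟩ := exists_output_bound u K
  have hn := Code.evaln_bound hK
  refine ⟨m, fun z a => (Nat.unpair z).1 = a, fun z b => (Nat.unpair z).2 = b,
    fun c x y => (y : ℕ) ∈ Code.evaln K c x, by omega, ?_⟩
  constructor
  · exact fun x => lt_irrefl x
  · exact fun x y z => lt_trans
  · exact fun x y => lt_trichotomy x y
  · exact fun z => ⟨⟨_, (Nat.unpair_left_le z).trans_lt z.2⟩,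
      ⟨_, (Nat.unpair_right_le z).trans_lt z.2⟩, rfl, rfl⟩
  · intro z a b hz ha hb
    rw [isZero_fin] at hz
    exact ⟨isZero_fin.2 (by rw [← ha, hz]; simp), isZero_fin.2 (by rw [← hb, hz]; simp)⟩
  · intro z z' a b a' b' hz ha hb ha' hb'
    rw [isSucc_fin] at hz
    refine isNextPair_fin ?_
    rw [← ha, ← hb, ← ha', ← hb', Nat.pair_unpair, Nat.pair_unpair, hz]
  · exact fun c x y hxy => evalRule_fin hKm hm c x y hxy
  · exact fun x y hxy hy => lt_trans hxy hy
  · exact ⟨⟨n, by omega⟩, ⟨y, hm ⟨u, le_rfl⟩ _ _ hK⟩, by simp, fun w hw => hw, hK⟩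

end Computation

/-! ### Computations as finite models of a sentence -/


/-- The binary relations of a computation of `u`: the input, the order, the two unpairing
functions, and the graphs of the programs with a number of at most that of `u`. -/
abbrev Role (u : Code) : Type := Fin 4 ⊕ CodeLE u

section Roles

variable {u : Code} {s : Role u → ℕ × ℕ} (hsV : ∀ i, s i ∈ V)

/-- The binary relation given by the symbol for the role `i`. -/
def roleRel (i : Role u) {M : Type} [(voc V).Structure M] (x y : M) : Prop :=
  Language.Structure.RelMap (relSym (hsV i)) fun j => if (j : ℕ) = 0 then x else y

/-- The binary relation given by the symbol for the program `c`. -/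
def codeRel (c : Code) {M : Type} [(voc V).Structure M] (x y : M) : Prop :=
  ∃ h : Encodable.encode c ≤ Encodable.encode u, roleRel hsV (.inr ⟨c, h⟩) x y

theorem definableOver_roleRel (i : Role u) {n : ℕ} (a b : Fin n) :
    DefinableOver (V := V) V fun _ _ _ v => roleRel hsV i (v a) (v b) :=
  (DefinableOver.rel (hsV i) (hsV i) fun j => if (j : ℕ) = 0 then a else b).congr
    fun _ _ _ _ => by simp only [roleRel, apply_ite]

theorem definableOver_codeRel (c : Code) {n : ℕ} (a b : Fin n) :
    DefinableOver (V := V) V fun _ _ _ v => codeRel hsV c (v a) (v b) := by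
  by_cases h : Encodable.encode c ≤ Encodable.encode u
  · exact (definableOver_roleRel hsV (.inr ⟨c, h⟩) a b).congr
      fun _ _ _ _ => ⟨fun h' => ⟨h, h'⟩, fun ⟨_, h'⟩ => h'⟩
  · exact DefinableOver.false.congr fun _ _ _ _ => ⟨False.elim, fun ⟨h', _⟩ => h h'⟩

theorem definableOver_isZero (i : Role u) {n : ℕ} (a : Fin n) :
    DefinableOver (V := V) V fun _ _ _ v => IsZero (roleRel hsV i) (v a) :=
  .not (.ex (definableOver_roleRel hsV i _ _))

theorem definableOver_isSucc (i : Role u) {n : ℕ} (a b : Fin n) :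
    DefinableOver (V := V) V fun _ _ _ v => IsSucc (roleRel hsV i) (v a) (v b) :=
  .and (definableOver_roleRel hsV i _ _)
    (.not (.ex (.and (definableOver_roleRel hsV i _ _) (definableOver_roleRel hsV i _ _))))

theorem definableOver_isNextPair (i : Role u) {n : ℕ} (a b a' b' : Fin n) :
    DefinableOver (V := V) V fun _ _ _ v =>
      IsNextPair (roleRel hsV i) (v a) (v b) (v a') (v b') :=
  have lt (a b : Fin n) := definableOver_roleRel hsV i a b
  have succ (a b : Fin n) := definableOver_isSucc hsV i a b
  have zero (a : Fin n) := definableOver_isZero hsV i a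
  .or (.and (lt _ _) (.and (succ _ _) (.and (lt _ _) (.eq _ _))))
    (.or (.and (succ _ _) (.and (.eq _ _) (zero _)))
      (.or (.and (lt _ _) (.and (.eq _ _) (succ _ _))) (.and (.eq _ _) (.and (zero _) (succ _ _)))))

theorem definableOver_evalRule (i j k : Role u) (c : Code) {n : ℕ} (a b : Fin n) :
    DefinableOver (V := V) V fun _ _ _ v =>
      EvalRule (roleRel hsV i) (roleRel hsV j) (roleRel hsV k) (fun c => codeRel hsV c) c (v a) (v b) := by
  cases c with
  | zero => exact definableOver_isZero hsV i _
  | succ => exact definableOver_isSucc hsV i _ _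
  | left => exact definableOver_roleRel hsV j _ _
  | right => exact definableOver_roleRel hsV k _ _
  | pair | comp | prec | rfind' =>
    simp only [EvalRule]
    repeat' first
      | exact definableOver_roleRel hsV _ _ _
      | exact definableOver_codeRel hsV _ _ _
      | exact definableOver_isZero hsV _ _
      | exact definableOver_isSucc hsV _ _ _
      | exact .eq _ _
      | apply DefinableOver.ex
      | apply DefinableOver.and
      | apply DefinableOver.or
      | apply DefinableOver.not

/-- The relations of the structure record a halting computation of `u`. -/
def RecordsComputation (M : Type) [(voc V).Structure M] : Prop :=
  IsComputation u (diagonal (hsV (.inl 0)) : M → Prop) (roleRel hsV (.inl 1))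
    (roleRel hsV (.inl 2)) (roleRel hsV (.inl 3)) (fun c => codeRel hsV c)

theorem definableOver_recordsComputation :
    DefinableOver (V := V) V (n := 0) fun M _ _ _ => RecordsComputation hsV M := by
  -- Spelling the structure out as a conjunction exposes it to the closure rules. The quantifier
  -- over programs is external and becomes a finite conjunction.
  refine DefinableOver.congr (A := fun M _ _ _ =>
    (∀ x : M, ¬ roleRel hsV (.inl 1) x x) ∧
    (∀ x y z : M, roleRel hsV (.inl 1) x y → roleRel hsV (.inl 1) y z →
      roleRel hsV (.inl 1) x z) ∧
    (∀ x y : M, roleRel hsV (.inl 1) x y ∨ x = y ∨ roleRel hsV (.inl 1) y x) ∧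
    (∀ z : M, ∃ a b, roleRel hsV (.inl 2) z a ∧ roleRel hsV (.inl 3) z b) ∧
    (∀ z a b : M, IsZero (roleRel hsV (.inl 1)) z → roleRel hsV (.inl 2) z a →
      roleRel hsV (.inl 3) z b →
      IsZero (roleRel hsV (.inl 1)) a ∧ IsZero (roleRel hsV (.inl 1)) b) ∧
    (∀ z z' a b a' b' : M, IsSucc (roleRel hsV (.inl 1)) z z' → roleRel hsV (.inl 2) z a →
      roleRel hsV (.inl 3) z b → roleRel hsV (.inl 2) z' a' → roleRel hsV (.inl 3) z' b' →
      IsNextPair (roleRel hsV (.inl 1)) a b a' b') ∧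
    (∀ c : CodeLE u, ∀ x y : M, codeRel hsV c.1 x y → EvalRule (roleRel hsV (.inl 1))
      (roleRel hsV (.inl 2)) (roleRel hsV (.inl 3)) (fun c => codeRel hsV c) c.1 x y) ∧
    (∀ x y : M, roleRel hsV (.inl 1) x y → diagonal (hsV (.inl 0)) y →
      diagonal (hsV (.inl 0)) x) ∧
    (∃ x y : M, ¬ diagonal (hsV (.inl 0)) x ∧
      (∀ w, roleRel hsV (.inl 1) w x → diagonal (hsV (.inl 0)) w) ∧ codeRel hsV u x y)) ?_ ?_
  · refine .and ?_ (.and ?_ (.and ?_ (.and ?_ (.and ?_ (.and ?_ (.and (.forall_finite fun c => ?_)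
      (.and ?_ ?_)))))))
    all_goals
      repeat' first
        | exact definableOver_roleRel hsV _ _ _
        | exact definableOver_codeRel hsV _ _ _
        | exact definableOver_isZero hsV _ _
        | exact definableOver_isSucc hsV _ _ _
        | exact definableOver_isNextPair hsV _ _ _ _ _
        | exact definableOver_evalRule hsV _ _ _ _ _ _
        | exact definableOver_diagonal (hsV (.inl 0)) (hsV (.inl 0)) _
        | exact .eq _ _
        | apply DefinableOver.all
        | apply DefinableOver.ex
        | apply DefinableOver.and
        | apply DefinableOver.or
        | apply DefinableOver.not
        | apply DefinableOver.imp
  · exact fun M _ _ _ => ⟨fun ⟨h1, h2, h3, h4, h5, h6, h7, h8, h9⟩ =>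
      ⟨h1, h2, h3, h4, h5, h6, h7, h8, h9⟩, fun h => ⟨h.irrefl, h.trans, h.total, h.unpair_total,
        h.unpair_zero, h.unpair_succ, h.rule, h.initial, h.halts⟩⟩

/-- The structure in which the symbol for the role `i` is interpreted by the relation `B i`
between the first two arguments. -/
@[reducible]
def roleStructure (V : Set (ℕ × ℕ)) (s : Role u → ℕ × ℕ) {M : Type} (B : Role u → M → M → Prop) :
    (voc V).Structure M where
  funMap f := Empty.elim f
  RelMap {k} R xs := ∃ i, s i = (k, R.1) ∧ ∃ h : 2 ≤ k, B i (xs ⟨0, by omega⟩) (xs ⟨1, by omega⟩)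

theorem relMap_roleStructure (hs : Function.Injective s) (hs2 : ∀ i, 2 ≤ (s i).1) {M : Type}
    (B : Role u → M → M → Prop) (i : Role u) (xs : Fin (s i).1 → M) :
    (roleStructure V s B).RelMap (relSym (hsV i)) xs ↔
      B i (xs ⟨0, by have := hs2 i; omega⟩) (xs ⟨1, hs2 i⟩) := by
  constructor
  · rintro ⟨j, hj, _, hB⟩
    obtain rfl : j = i := hs hj
    exact hB
  · exact fun h => ⟨i, rfl, hs2 i, h⟩

/-- Soundness applies to an arbitrary model. Conversely, a halting run on an initial segment of `ℕ`
is encoded with all symbols ignoring arguments beyond the second, and the input symbol also ignoring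
the second. -/
theorem exists_recordsComputation_iff (hs : Function.Injective s) (hs2 : ∀ i, 2 ≤ (s i).1)
    (n : ℕ) : (∃ (M : Type) (_ : Finite M) (_ : Nonempty M) (_ : (voc V).Structure M),
      FirstArgOnly (hsV (.inl 0)) (by have := hs2 (.inl 0); omega) M ∧ RecordsComputation hsV M ∧
        {x : M | diagonal (hsV (.inl 0)) x}.ncard = n) ↔ (u.eval n).Dom := by
  constructor
  · rintro ⟨M, _, _, _, -, hM, rfl⟩
    exact hM.eval_dom
  · intro h
    obtain ⟨m, fst, snd, ev, hm, hcomp⟩ := exists_isComputation h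
    let B : Role u → Fin m → Fin m → Prop
      | .inl 0 => fun x _ => (x : ℕ) < n
      | .inl 1 => fun x y => x < y
      | .inl 2 => fst
      | .inl 3 => snd
      | .inr c => ev c.1
    let S := roleStructure V s B
    have hrel := relMap_roleStructure hsV hs hs2 B
    have hrole : ∀ i, (roleRel hsV i : Fin m → Fin m → Prop) = B i := fun i => by
      funext x y
      exact propext (hrel i _)
    have hdiag : (diagonal (hsV (.inl 0)) : Fin m → Prop) = fun x : Fin m => (x : ℕ) < n := by
      funext x
      exact propext (hrel (.inl 0) _)
    refine ⟨Fin m, inferInstance, ⟨⟨n, hm⟩⟩, S, ?_, ?_, ?_⟩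
    · intro xs
      rw [hdiag]
      exact hrel (.inl 0) xs
    · rw [RecordsComputation, hdiag, hrole, hrole, hrole]
      -- `codeRel` is empty for programs beyond `u`, unlike `ev`; the rules survive by
      -- `EvalRule.mono`.
      refine { hcomp with rule := fun c x y hxy => ?_, halts := ?_ }
      · obtain ⟨hc, hxy⟩ := hxy
        rw [hrole] at hxy
        exact (hcomp.rule c x y hxy).mono fun d hd x y hxy =>
          ⟨hd.trans c.2, by rw [hrole]; exact hxy⟩
      · obtain ⟨x, y, h1, h2, h3⟩ := hcomp.halts
        exact ⟨x, y, h1, h2, le_rfl, by rw [hrole]; exact h3⟩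
    · rw [hdiag]
      have : {x : Fin m | (x : ℕ) < n} = Set.range (Fin.castLE hm.le) := by
        ext x
        exact ⟨fun h => ⟨⟨x, h⟩, rfl⟩, by rintro ⟨y, rfl⟩; exact y.2⟩
      rw [this, Set.ncard_range_of_injective (Fin.castLE_injective hm.le), Nat.card_fin]

end Roles

/-! ### The halting problem as a complete recursively enumerable set -/

/-- One program serves all enumerable sets, which keeps the number of relation symbols independent
of the set being reduced. -/
theorem exists_universal_code : ∃ u : Code, ∀ q : ℕ → Prop, REPred q →
    ∃ c : ℕ, ∀ n, q n ↔ (u.eval (Nat.pair c n)).Dom := by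
  have huniv : Nat.Partrec fun n => (Denumerable.ofNat Code n.unpair.1).eval n.unpair.2 :=
    Partrec.nat_iff.1 (Code.eval_part.comp
      ((Computable.ofNat Code).comp (Computable.fst.comp Primrec.unpair.to_comp))
      (Computable.snd.comp Primrec.unpair.to_comp))
  obtain ⟨u, hu⟩ := Code.exists_code.1 huniv
  refine ⟨u, fun q hq => ?_⟩
  have hq' : Nat.Partrec fun n => (Part.assert (q n) fun _ => Part.some ()).map fun _ => 0 :=
    Partrec.nat_iff.1 (Partrec.map hq (Computable.const 0).to₂)
  obtain ⟨c, hc⟩ := Code.exists_code.1 hq'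
  refine ⟨Encodable.encode c, fun n => ?_⟩
  rw [hu]
  simp only [Nat.unpair_pair, Denumerable.ofNat_encode, hc]
  exact ⟨fun h => ⟨h, trivial⟩, fun h => h.fst⟩

/-! ### Hardness -/

/-- `ψ` need not count correctly in every finite structure: the conjunct `θ` confines attention to
those where its symbol is effectively unary. -/
theorem eval_dom_iff_finSat {u : Code} {s : Role u → ℕ × ℕ} (hsV : ∀ i, s i ∈ V)
    (hs : Function.Injective s) (hs2 : ∀ i, 2 ≤ (s i).1) (h0 : 0 < (s (.inl 0)).1)
    {θ ψ χ : (voc V).Sentence} {n : ℕ}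
    (hθ : ∀ (M : Type) [Finite M] [Nonempty M] [(voc V).Structure M],
      M ⊨ θ ↔ FirstArgOnly (hsV (.inl 0)) h0 M ∧ RecordsComputation hsV M)
    (hψ : symbols ψ ⊆ {s (.inl 0)})
    (hn : ∀ a < n + code ψ + 2, ∀ b < n + code ψ + 2, 0 < a + b →
      (@Language.Sentence.Realize _ (Fin (a + b))
        (colourStructure V fun x => (x : ℕ) < a) ψ ↔ a = n))
    (hχ : FinEquiv χ (θ ⊓ ψ)) : (u.eval n).Dom ↔ FinSat χ := by
  rw [← exists_recordsComputation_iff hsV hs hs2]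
  refine exists_congr fun M => exists_congr fun _ => exists_congr fun _ => exists_congr fun _ => ?_
  rw [hχ M, Language.Sentence.Realize, Language.Formula.realize_inf, ← Language.Sentence.Realize,
    ← Language.Sentence.Realize, hθ, ← and_assoc]
  exact and_congr_right fun h => (realize_iff_ncard_eq h0 (hsV (.inl 0)) h.1 ψ hψ hn).symm

theorem isREComplete_of_roles {u : Code}
    (hu : ∀ q : ℕ → Prop, REPred q → ∃ c : ℕ, ∀ n, q n ↔ (u.eval (Nat.pair c n)).Dom)
    {s : Role u → ℕ × ℕ} (hsV : ∀ i, s i ∈ V) (hs : Function.Injective s)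
    (hs2 : ∀ i, 2 ≤ (s i).1) {L : Set (voc V).Sentence} (hL : IsComputableFragment L)
    (hexp : IsEquiExpressive L) (hconj : IsEffectivelyClosedUnderConj L) :
    IsREComplete (FinSatProblem L) := by
  refine ⟨rePred_finSatProblem hL, fun q hq => ?_⟩
  obtain ⟨c, hc⟩ := hu q hq
  have h0 : 0 < (s (.inl 0)).1 := by have := hs2 (.inl 0); omega
  obtain ⟨θ₀, hθ₀V, hθ₀⟩ := ((definableOver_firstArgOnly (hsV (.inl 0)) (hsV (.inl 0)) h0).and
    (definableOver_recordsComputation hsV)).exists_sentence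
  -- A non-effective choice is harmless here, as `code θ` enters the reduction as a constant.
  obtain ⟨θ, hθL, -, hθ⟩ := hexp V subset_rfl θ₀ hθ₀V
  obtain ⟨g, hg, hgL⟩ := exists_computable_counting hL h0 (hsV (.inl 0)) fun n => by
    obtain ⟨ψ₀, hψ₀s, hψ₀⟩ := (definableOver_ncard_eq (τ := {s (.inl 0)}) (hsV (.inl 0))
      (Set.mem_singleton _) n).exists_sentence
    -- Taking the vocabulary to be a single symbol ensures that `ψ` mentions nothing else and can
    -- pass the test.
    obtain ⟨ψ, hψL, hψs, hψ⟩ := hexp {s (.inl 0)} (Set.singleton_subset_iff.2 (hsV _)) ψ₀ hψ₀s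
    refine ⟨ψ, hψL, hψs, fun a b hab => ?_⟩
    have : Nonempty (Fin (a + b)) := ⟨⟨0, hab⟩⟩
    let S := colourStructure V fun x : Fin (a + b) => (x : ℕ) < a
    have hdiag : ∀ x : Fin (a + b), diagonal (hsV (.inl 0)) x ↔ (x : ℕ) < a :=
      fun x => ⟨fun h => h.2, fun h => ⟨h0, h⟩⟩
    have hcard := (ncard_lt_and_not_lt a b True).1 trivial
    simp only [iff_true] at hcard
    rw [← hψ, hψ₀]
    simp only [hdiag, hcard]
  obtain ⟨F, hF, hFL⟩ := hconj
  refine ⟨fun n => F (code θ) (g (Nat.pair c n)), ?_, fun n => ?_⟩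
  · exact hF.comp (Computable.const _) (hg.comp
      (Primrec₂.natPair.to_comp.comp (Computable.const c) Computable.id))
  · beta_reduce
    obtain ⟨ψ, hψL, hψg, hψs, hψ⟩ := hgL (Nat.pair c n)
    obtain ⟨χ, hχL, hχF, hχ⟩ := hFL θ hθL ψ hψL
    rw [hc, eval_dom_iff_finSat hsV hs hs2 h0
      (fun M _ _ _ => (hθ M).symm.trans (hθ₀ M)) hψs hψ hχ, ← hψg, hχF]
    constructor
    · exact fun h => ⟨χ, hχL, rfl, h⟩
    · rintro ⟨χ', -, h', h⟩
      rwa [← code_injective h']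

end FinSatFragment

theorem theorem1p1 :
    ∃ N : ℕ, ∀ V : Set (ℕ × ℕ), (ComputablePred fun s : ℕ × ℕ => s ∈ V) →
      (N : ℕ∞) ≤ Set.encard {s ∈ V | 2 ≤ s.1} →
      ∀ L : Set (FinSatFragment.voc V).Sentence,
        FinSatFragment.IsComputableFragment L →
        FinSatFragment.IsEquiExpressive L →
        FinSatFragment.IsEffectivelyClosedUnderConj L →
        FinSatFragment.IsREComplete (FinSatFragment.FinSatProblem L) := by
  obtain ⟨u, hu⟩ := FinSatFragment.exists_universal_code
  -- One symbol is needed for each role; four roles and finitely many programs depend only on `u`.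
  refine ⟨Nat.card (FinSatFragment.Role u), fun V _ hV L hL hexp hconj => ?_⟩
  obtain ⟨t, htV, ht⟩ := Set.exists_subset_encard_eq hV
  have htfin : t.Finite := Set.finite_of_encard_eq_coe ht
  have hcard : Nat.card (FinSatFragment.Role u) = Nat.card t := by
    rw [Nat.card_coe_set_eq, Set.ncard, ht, ENat.toNat_natCast]
  have := htfin.to_subtype
  obtain ⟨e⟩ := Finite.card_eq.1 hcard
  exact FinSatFragment.isREComplete_of_roles hu (s := fun i => (e i : ℕ × ℕ))
    (fun i => (htV (e i).2).1) (Subtype.val_injective.comp e.injective)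
    (fun i => (htV (e i).2).2) hL hexp hconj
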